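/- **Setting.** Let $C$ be a CSS code on $n$ qubits, given by $X$- and $Z$-type stabilizer generators (supports $S_{X,p}$, $S_{Z,q}$ with $|S_{X,p}\cap S_{Z,q}|$ even), and let $L\ge 0$. The foliation of $C$ with $L$ rounds takes an $n$-qubit input through layers $t=1,\dots,2L$. In layer $t$, (i) every code qubit $i$ is teleported onto a fresh physical qubit $(i,t)$, prepared in $|+\rangle$, by a CZ gate with $(i,t-1)$ and an $X$-basis measurement of $(i,t-1)$ with outcome $m_{i,t}$; (ii) every $X$-type generator ($t$ odd), respectively $Z$-type generator ($t$ even), is measured by an ancilla prepared in $|+\rangle$, CZ gates (in any order) with the qubits $(i,t)$ in its support, and an $X$-basis measurement of the ancilla with outcome $s_{a,t}$. The space-time locations are: after each preparation, and on each of the two qubits after each CZ gate, for all ancillas and all qubits $(i,t)$ with $1\le t\le 2L$ (the input qubits $(i,0)$ carry no noise). For a physical qubit $\gamma$ (a code qubit in layer $t$, or the ancilla of a generator in layer $t$) let $W_\gamma$ be the number of its locations. At each location $\mathcal L$ a single-qubit channel $\mathcal N_{\mathcal L}$ acts. For given outcomes $\sigma$ of the cluster-state stabilizers, $\sigma_{a,t}=s_{a,t}+s_{a,t-2}+\sum_{i\in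 S_a}m_{i,t} \bmod 2$ (with $s_{a,t-2}=0$ in the first round), let $\mathcal E_\sigma[\{\mathcal N_{\mathcal L}\}](\rho)$ be the sum, over all measurement outcomes $(m,s)$ that yield $\sigma$, of the unnormalized output states after undoing the Pauli frame $\prod_i X_i^{m_{i,2}+m_{i,4}+\cdots+m_{i,2L}}Z_i^{m_{i,1}+m_{i,3}+\cdots+m_{i,2L-1}}$. Two noise models are *equivalent on the foliated code* if $\mathcal E_\sigma(\rho)$ is the same for all $\sigma$ and all operators $\rho$ supported on the code space. Write $[\mathcal N]_{P,P'}=\tfrac12\mathrm{Tr}[P^\dagger\mathcal N(P')]$ for the Pauli transfer matrix, $\mathcal P_z[p](\rho)=(1-p)\rho+pZ\rho Z$ and $\mathcal P_x[p](\rho)=(1-p)\rho+pX\rho X$. **Theorem.** Suppose that every $\mathcal N_{\mathcal L}$ has pure $Z$-coherence, i.e. $[\mathcal N_{\mathcal L}]_{P,XP}=[\mathcal N_{\mathcal L}]_{P,YP}=0$ for all $P\in\{I,X,Y,Z\}$ and $[\mathcal N_{\mathcal L}]_{Z,Z}=1$. For each physical qubit $\gamma$ let $x_\gamma$ be the $(X,X)$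 entry of the product of the $W_\gamma$ Pauli transfer matrices of the channels on $\gamma$, and let $q_\gamma=(1-x_\gamma)/2$. Then $q_\gamma\in[0,1]$, and $\{\mathcal N_{\mathcal L}\}$ is equivalent on the foliated code to 1. the single-qubit Pauli channels $\mathcal F_{\mathcal L}=\mathcal P_z[p_{\mathcal L}]$ at the same locations of the same circuit, with $p_{\mathcal L}=\tfrac12\bigl(1-\sqrt[W_\gamma]{x_\gamma}\bigr)$ for every location $\mathcal L$ on $\gamma$ (if $x_\gamma<0$ and $W_\gamma$ is even, the root is replaced by $\sqrt[W_\gamma]{|x_\gamma|}$, with a minus sign at the location after the preparation of $\gamma$); 2. incoherent flips of the code: $\mathcal E_\sigma[\{\mathcal N_{\mathcal L}\}](\rho)$ equals the result of $2L$ steps in which, at step $t$, each code qubit $i$ undergoes the bit flip $\mathcal P_x[q_{(i,t)}]$ ($t$ odd) or the phase flip $\mathcal P_z[q_{(i,t)}]$ ($t$ even), and then the $X$-type ($t$ odd) or $Z$-type ($t$ even) generators are measured projectively, each outcome being flipped independently with probability $q_{(a,t)}$, with reported outcomes $s'_{a,t}=\sigma_{a,t}+\sigma_{a,t-2}+\sigma_{a,t-4}+\cdots$.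 For each $\gamma$, the channels $\mathcal F_{\mathcal L}$ are obtained from one entry of a matrix that is computed with $W_\gamma-1$ multiplications of $4\times4$ matrices, in an order that does not depend on the channels or on the order of the CZ gates; and $W_\gamma\le\max(w+1,\,d+3)$, where $w$ is the largest weight of a generator and $d$ the largest number of generators of one type ($X$ or $Z$) acting on one qubit. -/

import Mathlib

namespace Foliation

/-! ### Single-qubit operators and channels -/

/-- Bits: measurement outcomes and labels of computational basis states. -/
abbrev Bit := ZMod 2

/-- The sign `(-1)^x`. -/
def sgn (x : Bit) : ℂ := if x = 0 then 1 else -1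

/-- Operators on one qubit. -/
abbrev Op1 := Matrix Bit Bit ℂ

/-- Linear maps on the operators of one qubit. -/
abbrev SuperOp1 := Op1 →ₗ[ℂ] Op1

/-- Labels of the single-qubit Pauli operators. -/
inductive Pauli
  | I | X | Y | Z
  deriving DecidableEq

instance : Fintype Pauli :=
  ⟨{.I, .X, .Y, .Z}, fun P => by cases P <;> decide⟩

/-- The Pauli matrices, in the basis `|0⟩, |1⟩`. -/
def Pauli.mat : Pauli → Op1
  | .I => 1
  | .X => Matrix.of fun a b => if a = b then 0 else 1
  | .Y => Matrix.of fun a b => if a = b then 0 else if a = 0 then -Complex.I else Complex.I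
  | .Z => Matrix.diagonal sgn

/-- The map `ρ ↦ A ρ A†`. -/
def conjBy (A : Op1) : SuperOp1 :=
  LinearMap.mulLeft ℂ A ∘ₗ LinearMap.mulRight ℂ A.conjTranspose

/-- Quantum channels: `ρ ↦ ∑ₖ Eₖ ρ Eₖ†` with `∑ₖ Eₖ† Eₖ = 1`. -/
def IsChannel (N : SuperOp1) : Prop :=
  ∃ (r : ℕ) (E : Fin r → Op1),
    ∑ k, (E k).conjTranspose * E k = 1 ∧ N = ∑ k, conjBy (E k)

/-- Pauli error channels: `ρ ↦ ∑_P p_P P ρ P†` for a probability distribution `p`. -/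
def IsPauliChannel (N : SuperOp1) : Prop :=
  ∃ p : Pauli → ℝ, (∀ P, 0 ≤ p P) ∧ ∑ P, p P = 1 ∧ N = ∑ P, (p P : ℂ) • conjBy P.mat

/-- `[N]_{A,B} = Tr[A† N(B)] / 2`, also for `A`, `B` that are Pauli operators times a phase. -/
noncomputable def ptmEntry (N : SuperOp1) (A B : Op1) : ℂ :=
  (A.conjTranspose * N B).trace / 2

/-- The `4 × 4` Pauli transfer matrix. -/
noncomputable def ptm (N : SuperOp1) : Matrix Pauli Pauli ℂ :=
  Matrix.of fun P P' => ptmEntry N P.mat P'.mat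

/-- Pure `Z`-coherence: `[N]_{P,XP} = [N]_{P,YP} = 0` for every Pauli `P`, and `[N]_{Z,Z} = 1`. -/
def PureZ (N : SuperOp1) : Prop :=
  (∀ P : Pauli, ptmEntry N P.mat (Pauli.X.mat * P.mat) = 0 ∧
    ptmEntry N P.mat (Pauli.Y.mat * P.mat) = 0) ∧
  ptmEntry N Pauli.Z.mat Pauli.Z.mat = 1

/-- The phase flip channel `ρ ↦ (1 - p) ρ + p Z ρ Z`. -/
noncomputable def phaseFlip (p : ℝ) : SuperOp1 :=
  ((1 - p : ℝ) : ℂ) • LinearMap.id + (p : ℂ) • conjBy Pauli.Z.mat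

/-! ### Multi-qubit operators -/

/-- Operators on the qubits labelled by `Q`, in the computational basis. -/
abbrev Op (Q : Type) := Matrix (Q → Bit) (Q → Bit) ℂ

/-- The two kinds of stabilizers of a CSS code. -/
inductive Kind
  | X | Z
  deriving DecidableEq

instance : Fintype Kind :=
  ⟨{.X, .Z}, fun b => by cases b <;> decide⟩

/-- The tensor products `∏ᵢ Xᵢ^{e i}` and `∏ᵢ Zᵢ^{e i}`. -/
def pauliOp {Q : Type} [Fintype Q] [DecidableEq Q] : Kind → (Q → Bit) → Op Q
  | .X, e => Matrix.of fun a b => if a = b + e then 1 else 0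
  | .Z, e => Matrix.diagonal fun a => sgn (∑ i, e i * a i)

/-- The map `Λ ⊗ id`, with the single-qubit map `Λ` acting on the qubit `v`. -/
noncomputable def onQubit {Q : Type} [DecidableEq Q] (v : Q) (Λ : SuperOp1) (ρ : Op Q) : Op Q :=
  Matrix.of fun a b => ∑ x : Bit, ∑ y : Bit,
    Λ (Matrix.single x y 1) (a v) (b v) * ρ (Function.update a v x) (Function.update b v y)

/-- Conjugation by the gate `CZ` on the qubits `u` and `v`. -/
def applyCZ {Q : Type} (u v : Q) (ρ : Op Q) : Op Q :=
  Matrix.of fun a b => sgn (a u * a v) * ρ a b * sgn (b u * b v)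

/-- The elementary steps of a circuit between state preparation and measurement. -/
inductive Instr (Q : Type)
  | cz (u v : Q)
  | noise (v : Q) (Λ : SuperOp1)

/-- The action of a single step. -/
noncomputable def Instr.apply {Q : Type} [DecidableEq Q] : Instr Q → Op Q → Op Q
  | .cz u v, ρ => applyCZ u v ρ
  | .noise v Λ, ρ => onQubit v Λ ρ

/-- Run a circuit; the head of the list acts first. -/
noncomputable def runCircuit {Q : Type} [DecidableEq Q] (c : List (Instr Q)) (ρ : Op Q) : Op Q :=
  c.foldl (fun ρ g => g.apply ρ) ρ

/-! ### CSS codes -/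

/-- A CSS code on `n` qubits, given by the supports of its `X` and `Z` stabilizer generators.
The generators need not be independent. -/
structure CSSCode (n : ℕ) where
  /-- the number of generators of each kind -/
  num : Kind → ℕ
  /-- the supports of the generators -/
  supp : (b : Kind) → Fin (num b) → Finset (Fin n)
  /-- `X` and `Z` generators commute -/
  comm : ∀ p q, Even (supp .X p ∩ supp .Z q).card

variable {n : ℕ}

/-- The stabilizer generators as operators. -/
def CSSCode.stab (C : CSSCode n) (b : Kind) (a : Fin (C.num b)) : Op (Fin n) :=
  pauliOp b fun i => if i ∈ C.supp b a then 1 else 0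

/-- Operators supported on the code space (for a density operator: code states). -/
def CSSCode.IsCodeOp (C : CSSCode n) (ρ : Op (Fin n)) : Prop :=
  ∀ b a, C.stab b a * ρ = ρ ∧ ρ * C.stab b a = ρ

/-- The number of generators of kind `b` that act on the qubit `i`. -/
def CSSCode.degree (C : CSSCode n) (b : Kind) (i : Fin n) : ℕ :=
  (Finset.univ.filter fun a => i ∈ C.supp b a).card

/-- The largest weight of a generator. -/
def CSSCode.maxWeight (C : CSSCode n) : ℕ :=
  Finset.univ.sup fun b => Finset.univ.sup fun a => (C.supp b a).card

/-- The largest number of generators of one kind that act on one qubit. -/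
def CSSCode.maxDegree (C : CSSCode n) : ℕ :=
  Finset.univ.sup fun b => Finset.univ.sup fun i => C.degree b i

/-! ### Space-time locations

Each of the `L` rounds `k = 0, …, L - 1` of syndrome extraction consists of a layer `(k, X)`
followed by a layer `(k, Z)`; the layer `(k, X)` is time `t = 2k + 1` and the layer `(k, Z)` is
time `t = 2k + 2` of the foliation. In each layer every code qubit is teleported to a fresh
physical qubit, and the generators of the kind of the layer are measured. -/

/-- The locations of single-qubit noise: after each preparation, and on each of the two qubits
after each `CZ` gate. -/
inductive Loc (C : CSSCode n)
  /-- the physical qubit of code qubit `i` in layer `(k, b)`, after its preparation -/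
  | codePrep (k : ℕ) (b : Kind) (i : Fin n)
  /-- the same qubit, after the gate with its predecessor in the teleportation chain -/
  | codeIn (k : ℕ) (b : Kind) (i : Fin n)
  /-- the same qubit, after the gate with the ancilla of the generator `a` -/
  | codeStab (k : ℕ) (b : Kind) (a : Fin (C.num b)) (i : Fin n)
  /-- the same qubit, after the gate with its successor in the teleportation chain -/
  | codeOut (k : ℕ) (b : Kind) (i : Fin n)
  /-- the ancilla of the generator `a`, after its preparation -/
  | ancPrep (k : ℕ) (b : Kind) (a : Fin (C.num b))
  /-- the same ancilla, after the gate with code qubit `i` -/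
  | ancStab (k : ℕ) (b : Kind) (a : Fin (C.num b)) (i : Fin n)

/-- The physical qubits: one for each code qubit and layer, one for each generator and round. -/
inductive Site (C : CSSCode n)
  | code (k : ℕ) (b : Kind) (i : Fin n)
  | anc (k : ℕ) (b : Kind) (a : Fin (C.num b))

/-- The round to which a physical qubit belongs. -/
def Site.round {C : CSSCode n} : Site C → ℕ
  | .code k _ _ => k
  | .anc k _ _ => k

/-- The physical qubit at which a location lies. -/
def Loc.site {C : CSSCode n} : Loc C → Site C
  | .codePrep k b i => .code k b i
  | .codeIn k b i => .code k b i
  | .codeStab k b _ i => .code k b i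
  | .codeOut k b i => .code k b i
  | .ancPrep k b a => .anc k b a
  | .ancStab k b a _ => .anc k b a

/-- Whether the location directly follows the preparation of its qubit. -/
def Loc.isPrep {C : CSSCode n} : Loc C → Prop
  | .codePrep _ _ _ => True
  | .ancPrep _ _ _ => True
  | _ => False

/-- All the locations on a physical qubit in a foliation with `L` rounds. The code qubits of the
last layer have no successor. -/
def Site.locs {C : CSSCode n} (L : ℕ) : Site C → List (Loc C)
  | .code k b i =>
      [.codePrep k b i, .codeIn k b i] ++
      ((List.finRange (C.num b)).filter fun a => i ∈ C.supp b a).map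
        (fun a => .codeStab k b a i) ++
      (if b = .Z ∧ k + 1 = L then [] else [.codeOut k b i])
  | .anc k b a =>
      .ancPrep k b a ::
      ((List.finRange n).filter fun i => i ∈ C.supp b a).map (fun i => .ancStab k b a i)

/-- The number `W` of locations on a physical qubit. -/
def Site.W {C : CSSCode n} (L : ℕ) (γ : Site C) : ℕ := (γ.locs L).length

/-- The locations that occur in the foliation with `L` rounds. -/
def Loc.Occurs {C : CSSCode n} (L : ℕ) (l : Loc C) : Prop :=
  l.site.round < L ∧ l ∈ l.site.locs L

/-! ### The foliation circuit -/

/-- An order of the `CZ` gates between ancillas and code qubits in each layer: every pair of a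
generator and a qubit in its support, exactly once. -/
structure Schedule (C : CSSCode n) (L : ℕ) where
  /-- the sequence of gates of each layer -/
  seq : Fin L → (b : Kind) → List (Fin (C.num b) × Fin n)
  nodup : ∀ k b, (seq k b).Nodup
  mem_iff : ∀ k b x, x ∈ seq k b ↔ x.2 ∈ C.supp b x.1

/-- The physical qubits that are present in one layer: the `n` old qubits of the chains, the `n`
fresh ones, and the ancillas. -/
abbrev Wire (n r : ℕ) := Fin n ⊕ Fin n ⊕ Fin r

/-- An old qubit. -/
abbrev Wire.old {n r : ℕ} (i : Fin n) : Wire n r := Sum.inl i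

/-- A fresh qubit. -/
abbrev Wire.new {n r : ℕ} (i : Fin n) : Wire n r := Sum.inr (Sum.inl i)

/-- An ancilla. -/
abbrev Wire.anc {n r : ℕ} (a : Fin r) : Wire n r := Sum.inr (Sum.inr a)

/-- The state `ρ ⊗ |+⟩⟨+| ⊗ ⋯ ⊗ |+⟩⟨+|`, with `ρ` on the old qubits. -/
noncomputable def prepare {n r : ℕ} (ρ : Op (Fin n)) : Op (Wire n r) :=
  Matrix.of fun a b => ρ (fun i => a (.old i)) (fun i => b (.old i)) * (1 / 2) ^ (n + r)

/-- The measurement of all old qubits and all ancillas in the `X` basis, with outcomes `m` and `s`;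
the result is the unnormalized state of the fresh qubits. Here `⟨m_X|x⟩ = (-1)^{m x} / √2`. -/
noncomputable def measureX {n r : ℕ} (m : Fin n → Bit) (s : Fin r → Bit) (ρ : Op (Wire n r)) :
    Op (Fin n) :=
  Matrix.of fun x y => ∑ u : Fin n → Bit, ∑ v : Fin n → Bit, ∑ c : Fin r → Bit, ∑ d : Fin r → Bit,
    (∏ i, sgn (m i * u i) * sgn (m i * v i) / 2) * (∏ a, sgn (s a * c a) * sgn (s a * d a) / 2) *
      ρ (Sum.elim u (Sum.elim x c)) (Sum.elim v (Sum.elim y d))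

/-- The noise on the old qubit of chain `i` after its gate with the fresh qubit of layer `(k, b)`.
The input qubits of the whole foliation carry no noise. -/
def outNoise {C : CSSCode n} (N : Loc C → SuperOp1) (k : ℕ) : Kind → Fin n → SuperOp1
  | .X, i => if k = 0 then LinearMap.id else N (.codeOut (k - 1) .Z i)
  | .Z, i => N (.codeOut k .X i)

/-- The circuit of the layer `(k, b)` between preparation and measurement: the teleportation gates,
then the gates between ancillas and fresh qubits, with noise after each preparation and gate. -/
def layerCircuit {C : CSSCode n} {L : ℕ} (S : Schedule C L) (N : Loc C → SuperOp1) (k : Fin L)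
    (b : Kind) : List (Instr (Wire n (C.num b))) :=
  (List.finRange n).map (fun i => .noise (.new i) (N (.codePrep k b i))) ++
  (List.finRange (C.num b)).map (fun a => .noise (.anc a) (N (.ancPrep k b a))) ++
  (List.finRange n).flatMap (fun i =>
    [.cz (.old i) (.new i),
     .noise (.old i) (outNoise N k b i),
     .noise (.new i) (N (.codeIn k b i))]) ++
  (S.seq k b).flatMap (fun x =>
    [.cz (.anc x.1) (.new x.2),
     .noise (.anc x.1) (N (.ancStab k b x.1 x.2)),
     .noise (.new x.2) (N (.codeStab k b x.1 x.2))])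

/-- One layer, for given outcomes `m` of the teleportations and `s` of the ancillas. -/
noncomputable def layer {C : CSSCode n} {L : ℕ} (S : Schedule C L) (N : Loc C → SuperOp1)
    (k : Fin L) (b : Kind) (m : Fin n → Bit) (s : Fin (C.num b) → Bit) (ρ : Op (Fin n)) :
    Op (Fin n) :=
  measureX m s (runCircuit (layerCircuit S N k b) (prepare ρ))

/-- The outcomes of the teleportations in all layers. -/
abbrev TeleOutcomes (n L : ℕ) := Fin L → Kind → Fin n → Bit

/-- One bit for each generator and round. -/
abbrev StabOutcomes (C : CSSCode n) (L : ℕ) := Fin L → (b : Kind) → Fin (C.num b) → Bit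

/-- The unnormalized state after `L` rounds, for given outcomes of all measurements. -/
noncomputable def foliate {C : CSSCode n} {L : ℕ} (S : Schedule C L) (N : Loc C → SuperOp1)
    (m : TeleOutcomes n L) (s : StabOutcomes C L) (ρ : Op (Fin n)) : Op (Fin n) :=
  (List.finRange L).foldl
    (fun ρ k => layer S N k .Z (m k .Z) (s k .Z) (layer S N k .X (m k .X) (s k .X) ρ)) ρ

/-- The Pauli frame `X^{m₂ + m₄ + ⋯} Z^{m₁ + m₃ + ⋯}` on each code qubit after all layers. -/
def pauliFrame {L : ℕ} (m : TeleOutcomes n L) : Op (Fin n) :=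
  pauliOp .X (fun i => ∑ k, m k .Z i) * pauliOp .Z (fun i => ∑ k, m k .X i)

/-- The outcomes `s_t + s_{t-2} + u_t(m_t)` of the cluster state stabilizers, where `u_t(m_t)` is
the parity of `m_t` on the support of the generator, and `s_{t-2}` is absent in the first round. -/
def clusterSyndrome {C : CSSCode n} {L : ℕ} (m : TeleOutcomes n L) (s : StabOutcomes C L) :
    StabOutcomes C L :=
  fun k b a => s k b a + (if 0 < k.val then s ⟨k.val - 1, by omega⟩ b a else 0) +
    ∑ i ∈ C.supp b a, m k b i

/-- The output of the noisy foliation after the Pauli frame update, for given outcomes `σ` of the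
cluster state stabilizers, averaged over everything else. Its trace is the probability of `σ`. -/
noncomputable def foliationOutput {C : CSSCode n} {L : ℕ} (S : Schedule C L)
    (N : Loc C → SuperOp1) (σ : StabOutcomes C L) (ρ : Op (Fin n)) : Op (Fin n) :=
  ∑ m : TeleOutcomes n L, ∑ s : StabOutcomes C L,
    if clusterSyndrome m s = σ then
      (pauliFrame m).conjTranspose * foliate S N m s ρ * pauliFrame m
    else 0

/-! ### The code under independent flips

Ordinary syndrome extraction on the code: in each layer first the code qubits are flipped
independently, then the generators are measured projectively and the outcomes flipped. -/

/-- The probability of the pattern `e` of independent flips with probabilities `q`. -/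
noncomputable def flipWeight {r : ℕ} (q : Fin r → ℝ) (e : Fin r → Bit) : ℝ :=
  ∏ i, if e i = 0 then 1 - q i else q i

/-- Bit flip channels (`b = X`) or phase flip channels (`b = Z`) with probability `q i` on each
code qubit `i`. -/
noncomputable def flipNoise (b : Kind) (q : Fin n → ℝ) (ρ : Op (Fin n)) : Op (Fin n) :=
  ∑ e : Fin n → Bit, (flipWeight q e : ℂ) • (pauliOp b e * ρ * (pauliOp b e).conjTranspose)

/-- The product of the projectors `(1 + (-1)^{s a} S_a) / 2` over the generators of kind `b`. -/
noncomputable def CSSCode.projector (C : CSSCode n) (b : Kind) (s : Fin (C.num b) → Bit) :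
    Op (Fin n) :=
  (List.ofFn fun a => (1 / 2 : ℂ) • (1 + sgn (s a) • C.stab b a)).prod

/-- The measurement of the generators of kind `b` with reported outcomes `s`, each of which is
flipped with probability `q a`. -/
noncomputable def CSSCode.flippedMeasurement (C : CSSCode n) (b : Kind) (q : Fin (C.num b) → ℝ)
    (s : Fin (C.num b) → Bit) (ρ : Op (Fin n)) : Op (Fin n) :=
  ∑ f : Fin (C.num b) → Bit, (flipWeight q f : ℂ) •
    (C.projector b (s + f) * ρ * (C.projector b (s + f)).conjTranspose)

/-- The generator outcomes in the Pauli frame, of which the cluster state stabilizers are the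
differences between consecutive rounds. -/
def frameSyndrome {C : CSSCode n} {L : ℕ} (σ : StabOutcomes C L) : StabOutcomes C L :=
  fun k b a => ∑ j ∈ Finset.Iic k, σ j b a

/-- `L` rounds of syndrome extraction where the flip probability at each code qubit and layer, and
at each measurement, is `q γ`. -/
noncomputable def flipModelOutput (C : CSSCode n) {L : ℕ} (q : Site C → ℝ) (σ : StabOutcomes C L)
    (ρ : Op (Fin n)) : Op (Fin n) :=
  let half (k : Fin L) (b : Kind) (ρ : Op (Fin n)) : Op (Fin n) :=
    C.flippedMeasurement b (fun a => q (.anc k b a)) (frameSyndrome σ k b)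
      (flipNoise b (fun i => q (.code k b i)) ρ)
  (List.finRange L).foldl (fun ρ k => half k .Z (half k .X ρ)) ρ

/-! ### Computing the Pauli channels -/

/-- Programs that multiply `4 × 4` matrices, with the inputs labelled by `ι`. -/
inductive MulProg (ι : Type)
  | input (l : ι)
  | mul (e f : MulProg ι)

namespace MulProg

/-- The result of a program. -/
noncomputable def eval {ι : Type} (v : ι → Matrix Pauli Pauli ℂ) :
    MulProg ι → Matrix Pauli Pauli ℂ
  | .input l => v l
  | .mul e f => e.eval v * f.eval v

/-- The number of matrix multiplications that a program performs. -/
def mults {ι : Type} : MulProg ι → ℕ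
  | .input _ => 0
  | .mul e f => e.mults + f.mults + 1

/-- The inputs that a program reads. -/
def inputs {ι : Type} : MulProg ι → List ι
  | .input l => [l]
  | .mul e f => e.inputs ++ f.inputs

end MulProg

/-- The entry `x = [N_γ]_{X,X}` of the computed Pauli transfer matrix of the combined error `N_γ`
on the physical qubit `γ`. -/
noncomputable def xEntry {C : CSSCode n} (prog : Site C → MulProg (Loc C)) (N : Loc C → SuperOp1)
    (γ : Site C) : ℝ :=
  ((prog γ).eval (fun l => ptm (N l)) .X .X).re

/-- The total flip probability `(1 - x) / 2` on the physical qubit `γ`. For a combined error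
`ρ ↦ A ρ A†` with `A = α + β Z` it is `|β|²`. -/
noncomputable def totalFlip {C : CSSCode n} (prog : Site C → MulProg (Loc C))
    (N : Loc C → SuperOp1) (γ : Site C) : ℝ :=
  (1 - xEntry prog N γ) / 2

open Classical in
/-- The flip probability `(1 - x^{1/W}) / 2` at a single location. For odd `W` the root is the real
one; for even `W` and `x < 0`, where there is no real root, the root of `|x|` is used, with the sign
reversed at the location that follows the preparation. -/
noncomputable def locFlip {C : CSSCode n} (L : ℕ) (prog : Site C → MulProg (Loc C))
    (N : Loc C → SuperOp1) (l : Loc C) : ℝ :=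
  let x := xEntry prog N l.site
  let r := |x| ^ ((1 : ℝ) / (l.site.W L : ℝ))
  if x < 0 ∧ (Odd (l.site.W L) ∨ l.isPrep) then (1 + r) / 2 else (1 - r) / 2

/-- The Pauli channels that replace the channels `N`: phase flips on the physical qubits. On a code
qubit in an odd layer this is a bit flip of the code, since the teleportations have applied an odd
number of Hadamard gates; on an ancilla it flips the outcome of the `X` measurement. -/
noncomputable def pauliReplacement {C : CSSCode n} (L : ℕ) (prog : Site C → MulProg (Loc C))
    (N : Loc C → SuperOp1) (l : Loc C) : SuperOp1 :=
  phaseFlip (locFlip L prog N l)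

end Foliation

/-!
A channel with `[N]_{Z,Z} = 1` has diagonal Kraus operators, so it is a dephasing map: it
multiplies `|0⟩⟨1|` by a complex number, its coherence. Such maps act by entrywise multiplication,
and so do `CZ` gates, so they commute with each other. A layer of the foliation is therefore, up
to the Pauli frame, a Hadamard gate on every qubit followed by entrywise multipliers, in which
only the product of the coherences on each physical qubit occurs. Summing over the teleportation
outcomes averages over the Pauli frame, which replaces the product on a code qubit by its real
part. An operator that commutes with the stabilizers being measured vanishes between basis states
of different syndromes, so the product on an ancilla also matters only through its real part. This
real part is `x_γ`, and the coherence `1 - 2 p` of a phase flip channel is real.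
-/

namespace Foliation

open scoped Matrix

/-! ### Signs and binary vectors -/

theorem Bit.eq_zero_or_one (x : Bit) : x = 0 ∨ x = 1 := by
  revert x; decide

@[simp] theorem sgn_zero : sgn 0 = 1 := by simp [sgn]

@[simp] theorem sgn_one : sgn 1 = -1 := by simp [sgn]

theorem sgn_add (x y : Bit) : sgn (x + y) = sgn x * sgn y := by
  rcases x.eq_zero_or_one with rfl | rfl <;> rcases y.eq_zero_or_one with rfl | rfl <;>
    simp [CharTwo.add_self_eq_zero]

@[simp] theorem sgn_mul_self (x : Bit) : sgn x * sgn x = 1 := by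
  rw [← sgn_add, CharTwo.add_self_eq_zero, sgn_zero]

@[simp] theorem star_sgn (x : Bit) : star (sgn x) = sgn x := by
  rcases x.eq_zero_or_one with rfl | rfl <;> simp

theorem sgn_sum {ι : Type*} (s : Finset ι) (f : ι → Bit) :
    sgn (∑ i ∈ s, f i) = ∏ i ∈ s, sgn (f i) := by
  classical
  induction s using Finset.induction_on with
  | empty => simp
  | insert a s ha ih => rw [Finset.sum_insert ha, Finset.prod_insert ha, sgn_add, ih]

theorem sgn_dotProduct {ι : Type*} [Fintype ι] (x y : ι → Bit) :
    sgn (x ⬝ᵥ y) = ∏ i, sgn (x i * y i) := sgn_sum _ _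

theorem sum_bit {M : Type*} [AddCommMonoid M] (f : Bit → M) : ∑ x, f x = f 0 + f 1 :=
  Fin.sum_univ_two f

theorem sum_sgn_dotProduct {ι : Type*} [Fintype ι] [DecidableEq ι] (z : ι → Bit) :
    ∑ u : ι → Bit, sgn (z ⬝ᵥ u) = if z = 0 then 2 ^ Fintype.card ι else 0 := by
  simp only [sgn_dotProduct]
  rw [← Fintype.prod_sum fun i c => sgn (z i * c)]
  split_ifs with hz
  · subst hz; simp
  · obtain ⟨i, hi⟩ := Function.ne_iff.1 hz
    have hi' : z i = 1 := (z i).eq_zero_or_one.resolve_left hi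
    exact Finset.prod_eq_zero (Finset.mem_univ i) (by simp [sum_bit, hi'])

theorem vec_add_self {ι : Type*} (x : ι → Bit) : x + x = 0 :=
  funext fun i => CharTwo.add_self_eq_zero (x i)

theorem vec_add_add_cancel {ι : Type*} (x e : ι → Bit) : x + e + e = x := by
  rw [add_assoc, vec_add_self, add_zero]

theorem vec_add_add_add_cancel {ι : Type*} (x y e : ι → Bit) : x + e + (y + e) = x + y := by
  rw [add_add_add_comm, vec_add_self, add_zero]

theorem vec_eq_add_iff {ι : Type*} {x y e : ι → Bit} : x = y + e ↔ y = x + e :=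
  ⟨fun h => by rw [h, vec_add_add_cancel], fun h => by rw [h, vec_add_add_cancel]⟩

theorem vec_add_eq_zero_iff {ι : Type*} {x y : ι → Bit} : x + y = 0 ↔ x = y := by
  rw [eq_comm, vec_eq_add_iff, zero_add, eq_comm]

/-! ### Hadamard gates and Pauli frames -/

section Frames

variable {Q : Type} [Fintype Q] [DecidableEq Q]

theorem pauliOp_X_apply (e x y : Q → Bit) :
    pauliOp .X e x y = if x = y + e then 1 else 0 := rfl

theorem pauliOp_Z_apply (e x y : Q → Bit) :
    pauliOp .Z e x y = if x = y then sgn (e ⬝ᵥ x) else 0 := Matrix.diagonal_apply ..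

theorem pauliOp_conjTranspose (b : Kind) (e : Q → Bit) : (pauliOp b e)ᴴ = pauliOp b e := by
  ext x y
  cases b
  · simp only [Matrix.conjTranspose_apply, pauliOp_X_apply, vec_eq_add_iff (x := x)]
    split_ifs <;> simp
  · simp only [Matrix.conjTranspose_apply, pauliOp_Z_apply, eq_comm (a := x)]
    split_ifs with h <;> simp [h]

theorem pauliOp_X_mul_apply (e : Q → Bit) (ρ : Op Q) (x y : Q → Bit) :
    (pauliOp .X e * ρ) x y = ρ (x + e) y := by
  simp [Matrix.mul_apply, pauliOp_X_apply, vec_eq_add_iff (x := x)]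

theorem mul_pauliOp_X_apply (e : Q → Bit) (ρ : Op Q) (x y : Q → Bit) :
    (ρ * pauliOp .X e) x y = ρ x (y + e) := by
  simp [Matrix.mul_apply, pauliOp_X_apply]

theorem pauliOp_Z_mul_apply (e : Q → Bit) (ρ : Op Q) (x y : Q → Bit) :
    (pauliOp .Z e * ρ) x y = sgn (e ⬝ᵥ x) * ρ x y :=
  Matrix.diagonal_mul ..

theorem mul_pauliOp_Z_apply (e : Q → Bit) (ρ : Op Q) (x y : Q → Bit) :
    (ρ * pauliOp .Z e) x y = ρ x y * sgn (e ⬝ᵥ y) :=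
  Matrix.mul_diagonal ..

theorem pauliOp_mul_self (b : Kind) (e : Q → Bit) : pauliOp b e * pauliOp b e = 1 := by
  ext x y
  cases b
  · rw [pauliOp_X_mul_apply, pauliOp_X_apply, Matrix.one_apply]
    simp only [add_left_inj]
  · rw [pauliOp_Z_mul_apply, pauliOp_Z_apply, Matrix.one_apply, mul_ite, sgn_mul_self, mul_zero]

/-- Conjugation by the Pauli operator `∏ᵢ Xᵢ^{f i} Zᵢ^{g i}`, the effect of a Pauli frame. -/
def frameConj (f g : Q → Bit) (ρ : Op Q) : Op Q :=
  (pauliOp .X f * pauliOp .Z g) * ρ * (pauliOp .X f * pauliOp .Z g)ᴴ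

theorem frameConj_apply (f g : Q → Bit) (ρ : Op Q) (x y : Q → Bit) :
    frameConj f g ρ x y = sgn (g ⬝ᵥ (x + y)) * ρ (x + f) (y + f) := by
  rw [frameConj, Matrix.conjTranspose_mul, pauliOp_conjTranspose, pauliOp_conjTranspose,
    Matrix.mul_assoc, Matrix.mul_assoc, pauliOp_X_mul_apply, pauliOp_Z_mul_apply,
    ← Matrix.mul_assoc, mul_pauliOp_X_apply, mul_pauliOp_Z_apply,
    ← vec_add_add_add_cancel x y f, dotProduct_add g (x + f), sgn_add]
  ring

theorem pauliOp_X_conj_eq_frameConj (e : Q → Bit) (ρ : Op Q) :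
    pauliOp .X e * ρ * (pauliOp .X e)ᴴ = frameConj e 0 ρ := by
  ext x y
  simp [pauliOp_conjTranspose, mul_pauliOp_X_apply, pauliOp_X_mul_apply, frameConj_apply]

theorem pauliOp_Z_conj_eq_frameConj (e : Q → Bit) (ρ : Op Q) :
    pauliOp .Z e * ρ * (pauliOp .Z e)ᴴ = frameConj 0 e ρ := by
  ext x y
  rw [pauliOp_conjTranspose, mul_pauliOp_Z_apply, pauliOp_Z_mul_apply, frameConj_apply,
    dotProduct_add, sgn_add, add_zero, add_zero]
  ring

theorem frameConj_zero_zero (ρ : Op Q) : frameConj 0 0 ρ = ρ := by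
  ext x y; simp [frameConj_apply]

theorem frameConj_frameConj (f g f' g' : Q → Bit) (ρ : Op Q) :
    frameConj f g (frameConj f' g' ρ) = frameConj (f + f') (g + g') ρ := by
  ext x y
  rw [frameConj_apply, frameConj_apply, frameConj_apply, vec_add_add_add_cancel, add_dotProduct,
    sgn_add, add_assoc x, add_assoc y, mul_assoc]

theorem frameConj_smul (f g : Q → Bit) (c : ℂ) (ρ : Op Q) :
    frameConj f g (c • ρ) = c • frameConj f g ρ := by
  simp [frameConj]

theorem frameConj_hadamard (f g : Q → Bit) (M ρ : Op Q) :
    frameConj f g (M ⊙ ρ) = frameConj f 0 M ⊙ frameConj f g ρ := by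
  ext x y
  simp only [frameConj_apply, Matrix.hadamard_apply, zero_dotProduct, sgn_zero]
  ring

theorem conjTranspose_mul_frameConj_mul (f g : Q → Bit) (ρ : Op Q) :
    (pauliOp .X f * pauliOp .Z g)ᴴ * frameConj f g ρ * (pauliOp .X f * pauliOp .Z g) = ρ := by
  have hP : (pauliOp .X f * pauliOp .Z g)ᴴ * (pauliOp .X f * pauliOp .Z g) = (1 : Op Q) := by
    rw [Matrix.conjTranspose_mul, pauliOp_conjTranspose, pauliOp_conjTranspose, Matrix.mul_assoc,
      ← Matrix.mul_assoc (pauliOp .X f), pauliOp_mul_self, Matrix.one_mul, pauliOp_mul_self]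
  rw [frameConj, Matrix.mul_assoc, Matrix.mul_assoc, hP, Matrix.mul_one, ← Matrix.mul_assoc, hP,
    Matrix.one_mul]

variable (Q) in
/-- The Hadamard gate on every qubit. -/
noncomputable def hadamardGate : Op Q :=
  ((√2 : ℝ) : ℂ)⁻¹ ^ Fintype.card Q • Matrix.of fun x u => sgn (x ⬝ᵥ u)

theorem inv_sqrt_two_pow_mul_self (k : ℕ) :
    ((√2 : ℝ) : ℂ)⁻¹ ^ k * ((√2 : ℝ) : ℂ)⁻¹ ^ k = (1 / 2) ^ k := by
  rw [← mul_pow, ← mul_inv, ← Complex.ofReal_mul, Real.mul_self_sqrt (by norm_num)]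
  norm_num

omit [DecidableEq Q] in
theorem hadamardGate_conjTranspose : (hadamardGate Q)ᴴ = hadamardGate Q := by
  ext x y
  simp [hadamardGate, dotProduct_comm x y]

theorem hadamardGate_mul_self : hadamardGate Q * hadamardGate Q = 1 := by
  have h (x y u : Q → Bit) : sgn (x ⬝ᵥ u) * sgn (u ⬝ᵥ y) = sgn ((x + y) ⬝ᵥ u) := by
    rw [add_dotProduct, sgn_add, dotProduct_comm u y]
  ext x y
  rw [hadamardGate, Matrix.smul_mul, Matrix.mul_smul, smul_smul, inv_sqrt_two_pow_mul_self,
    Matrix.smul_apply, Matrix.mul_apply, Matrix.one_apply]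
  simp only [Matrix.of_apply, h, sum_sgn_dotProduct, vec_add_eq_zero_iff, smul_eq_mul, mul_ite,
    mul_zero, ← mul_pow]
  norm_num

theorem hadamardGate_mem_unitary : hadamardGate Q ∈ unitary (Op Q) := by
  rw [Unitary.mem_iff, Matrix.star_eq_conjTranspose, hadamardGate_conjTranspose,
    hadamardGate_mul_self, and_self]

/-- Conjugation by a Hadamard gate on every qubit. -/
noncomputable def hadConj : Op Q ≃⋆ₐ[ℂ] Op Q :=
  Unitary.conjStarAlgAut ℂ (Op Q) ⟨hadamardGate Q, hadamardGate_mem_unitary⟩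

theorem hadConj_eq (ρ : Op Q) : hadConj ρ = hadamardGate Q * ρ * hadamardGate Q := by
  rw [hadConj, Unitary.conjStarAlgAut_apply, Matrix.star_eq_conjTranspose,
    hadamardGate_conjTranspose]

theorem hadConj_hadConj (ρ : Op Q) : hadConj (hadConj ρ) = ρ := by
  rw [hadConj_eq, hadConj_eq, Matrix.mul_assoc, Matrix.mul_assoc, hadamardGate_mul_self,
    Matrix.mul_one, ← Matrix.mul_assoc, hadamardGate_mul_self, Matrix.one_mul]

theorem hadConj_apply (ρ : Op Q) (x y : Q → Bit) :
    hadConj ρ x y =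
      (1 / 2) ^ Fintype.card Q * ∑ u, ∑ v, sgn (x ⬝ᵥ u) * sgn (y ⬝ᵥ v) * ρ u v := by
  rw [hadConj_eq, hadamardGate, Matrix.mul_smul, Matrix.smul_mul, Matrix.smul_mul, smul_smul,
    inv_sqrt_two_pow_mul_self, Matrix.smul_apply, smul_eq_mul, Matrix.mul_assoc]
  simp only [Matrix.mul_apply, Matrix.of_apply, Finset.mul_sum, dotProduct_comm _ y]
  refine Finset.sum_congr rfl fun u _ => Finset.sum_congr rfl fun v _ => by ring

theorem hadamardGate_mul_pauliOp_X (e : Q → Bit) :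
    hadamardGate Q * pauliOp .X e = pauliOp .Z e * hadamardGate Q := by
  ext x y
  rw [mul_pauliOp_X_apply, pauliOp_Z_mul_apply]
  simp only [hadamardGate, Matrix.smul_apply, Matrix.of_apply, smul_eq_mul, dotProduct_add,
    sgn_add, dotProduct_comm e]
  ring

theorem hadConj_pauliOp_X (e : Q → Bit) : hadConj (pauliOp .X e) = pauliOp .Z e := by
  rw [hadConj_eq, hadamardGate_mul_pauliOp_X, Matrix.mul_assoc, hadamardGate_mul_self,
    Matrix.mul_one]

theorem hadConj_pauliOp_Z (e : Q → Bit) : hadConj (pauliOp .Z e) = pauliOp .X e := by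
  rw [← hadConj_pauliOp_X, hadConj_hadConj]

theorem hadConj_frameConj (f g : Q → Bit) (ρ : Op Q) :
    hadConj (frameConj f g ρ) = frameConj g f (hadConj ρ) := by
  have comm (ρ : Op Q) : pauliOp .Z f * (pauliOp .X g * ρ * (pauliOp .X g)ᴴ) * (pauliOp .Z f)ᴴ =
      frameConj g f ρ := by
    ext x y
    simp only [frameConj_apply, pauliOp_conjTranspose, mul_pauliOp_X_apply, mul_pauliOp_Z_apply,
      pauliOp_X_mul_apply, pauliOp_Z_mul_apply, dotProduct_add, sgn_add]
    ring
  rw [← comm, frameConj, map_mul, map_mul, ← Matrix.star_eq_conjTranspose, map_star, map_mul,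
    hadConj_pauliOp_X, hadConj_pauliOp_Z]
  simp only [Matrix.star_eq_conjTranspose, Matrix.conjTranspose_mul, Matrix.mul_assoc]

end Frames

/-! ### Dephasing channels -/

/-- Entrywise multiplication by a fixed matrix, as a linear map. -/
def schurMul {ι : Type*} (M : Matrix ι ι ℂ) : Matrix ι ι ℂ →ₗ[ℂ] Matrix ι ι ℂ where
  toFun ρ := M ⊙ ρ
  map_add' ρ τ := Matrix.hadamard_add M ρ τ
  map_smul' c ρ := Matrix.hadamard_smul M ρ c

/-- The factor by which dephasing with coherence `μ` multiplies the entry `(x, y)`: `μ` at `(0, 1)`,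
its conjugate at `(1, 0)`, and `1` on the diagonal. It is bundled as a homomorphism in `μ` because
composing dephasing maps multiplies their coherences. -/
def dephFactor (x y : Bit) : ℂ →* ℂ :=
  if x = y then 1 else if x = 0 then MonoidHom.id ℂ else (starRingEnd ℂ : ℂ →* ℂ)

@[simp] theorem dephFactor_self (x : Bit) (μ : ℂ) : dephFactor x x μ = 1 := by simp [dephFactor]

@[simp] theorem dephFactor_zero_one (μ : ℂ) : dephFactor 0 1 μ = μ := by simp [dephFactor]

@[simp] theorem dephFactor_one_zero (μ : ℂ) : dephFactor 1 0 μ = star μ := by simp [dephFactor]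

theorem dephFactor_ofReal (x y : Bit) (r : ℝ) :
    dephFactor x y r = if x = y then 1 else (r : ℂ) := by
  rcases x.eq_zero_or_one with rfl | rfl <;> rcases y.eq_zero_or_one with rfl | rfl <;> simp

theorem sum_dephFactor_add (x y : Bit) (μ : ℂ) :
    ∑ c, dephFactor (x + c) (y + c) μ = 2 * dephFactor x y μ.re := by
  have h11 : (1 : Bit) + 1 = 0 := CharTwo.add_self_eq_zero 1
  rcases x.eq_zero_or_one with rfl | rfl <;> rcases y.eq_zero_or_one with rfl | rfl <;>
    simp [sum_bit, h11, Complex.ext_iff] <;> ring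

/-- The single-qubit map that multiplies `|0⟩⟨1|` by the coherence `μ` and `|1⟩⟨0|` by its
conjugate; it is a channel if `‖μ‖ ≤ 1`. -/
def dephasing (μ : ℂ) : SuperOp1 := schurMul (Matrix.of fun x y => dephFactor x y μ)

theorem dephasing_apply (μ : ℂ) (ρ : Op1) (x y : Bit) :
    dephasing μ ρ x y = dephFactor x y μ * ρ x y := rfl

theorem dephasing_one : dephasing 1 = LinearMap.id := by
  ext ρ x y : 3
  simp [dephasing_apply]

theorem conjBy_apply (A ρ : Op1) : conjBy A ρ = A * ρ * Aᴴ := by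
  simp [conjBy, Matrix.mul_assoc]

theorem conjBy_diagonal_apply (d : Bit → ℂ) (ρ : Op1) (x y : Bit) :
    conjBy (Matrix.diagonal d) ρ x y = d x * star (d y) * ρ x y := by
  rw [conjBy_apply, Matrix.diagonal_conjTranspose, Matrix.mul_diagonal, Matrix.diagonal_mul,
    Pi.star_apply]
  ring

theorem phaseFlip_eq_dephasing (p : ℝ) : phaseFlip p = dephasing (1 - 2 * p : ℝ) := by
  ext ρ x y : 3
  rw [dephasing_apply, dephFactor_ofReal, phaseFlip, LinearMap.add_apply, LinearMap.smul_apply,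
    LinearMap.smul_apply, Matrix.add_apply, Matrix.smul_apply, Matrix.smul_apply, Pauli.mat,
    conjBy_diagonal_apply, star_sgn, LinearMap.id_apply, smul_eq_mul, smul_eq_mul]
  split_ifs with h
  · rw [h, sgn_mul_self]; push_cast; ring
  · have hxy : y = x + 1 := by revert x y; decide
    rw [hxy, sgn_add, sgn_one, mul_neg_one, mul_neg, sgn_mul_self]; push_cast; ring

theorem sum_pauli {M : Type*} [AddCommMonoid M] (f : Pauli → M) :
    ∑ P, f P = f .I + f .X + f .Y + f .Z := by
  simp [Finset.univ, Fintype.elems, Finset.sum_insert, add_assoc]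

theorem phaseFlip_isPauliChannel {p : ℝ} (hp : p ∈ Set.Icc (0 : ℝ) 1) :
    IsPauliChannel (phaseFlip p) := by
  refine ⟨fun P => match P with | .I => 1 - p | .Z => p | _ => 0, ?_, ?_, ?_⟩
  · rintro (_ | _ | _ | _) <;> simp [hp.1, hp.2]
  · rw [sum_pauli]; simp
  · have hI : conjBy Pauli.I.mat = LinearMap.id := by
      ext ρ : 1; simp [conjBy_apply, Pauli.mat]
    rw [sum_pauli, hI]; simp [phaseFlip]

/-! ### Channels with `[N]_{Z,Z} = 1` -/

section Kraus

variable {κ : Type*} [Fintype κ]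

theorem trace_sub_trace_conjBy_Z (E : Op1) :
    (Eᴴ * E).trace - (Pauli.Z.matᴴ * conjBy E Pauli.Z.mat).trace =
      2 * ((‖E 0 1‖ ^ 2 + ‖E 1 0‖ ^ 2 : ℝ) : ℂ) := by
  push_cast
  rw [conjBy_apply, ← Complex.mul_conj', ← Complex.mul_conj']
  simp only [Matrix.trace, sum_bit, Matrix.diag_apply, Matrix.mul_apply,
    Matrix.conjTranspose_apply, Pauli.mat, Matrix.diagonal_apply]
  simp
  ring

theorem ptmEntry_Z_sum_conjBy {E : κ → Op1} (hE : ∑ k, (E k)ᴴ * E k = 1) :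
    ptmEntry (∑ k, conjBy (E k)) Pauli.Z.mat Pauli.Z.mat =
      ((1 - ∑ k, (‖E k 0 1‖ ^ 2 + ‖E k 1 0‖ ^ 2) : ℝ) : ℂ) := by
  have htr : ∑ k, ((E k)ᴴ * E k).trace = 2 := by
    rw [← Matrix.trace_sum, hE, Matrix.trace_one, ZMod.card, Nat.cast_ofNat]
  have hsum := Finset.sum_congr rfl fun k (_ : k ∈ Finset.univ) => trace_sub_trace_conjBy_Z (E k)
  rw [Finset.sum_sub_distrib, htr, ← Finset.mul_sum] at hsum
  rw [ptmEntry, LinearMap.sum_apply, Finset.mul_sum, Matrix.trace_sum]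
  push_cast at hsum ⊢
  linear_combination -hsum / 2

theorem kraus_isDiag_of_ptmEntry_Z_eq_one {E : κ → Op1} (hE : ∑ k, (E k)ᴴ * E k = 1)
    (hZ : ptmEntry (∑ k, conjBy (E k)) Pauli.Z.mat Pauli.Z.mat = 1) (k : κ) : (E k).IsDiag := by
  rw [ptmEntry_Z_sum_conjBy hE, Complex.ofReal_eq_one, sub_eq_self] at hZ
  have hk := (Finset.sum_eq_zero_iff_of_nonneg fun k _ => by positivity).1 hZ k (Finset.mem_univ k)
  rw [add_eq_zero_iff_of_nonneg (by positivity) (by positivity), sq_eq_zero_iff, sq_eq_zero_iff,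
    norm_eq_zero, norm_eq_zero] at hk
  intro x y hxy
  rcases x.eq_zero_or_one with rfl | rfl <;> rcases y.eq_zero_or_one with rfl | rfl
  exacts [absurd rfl hxy, hk.1, hk.2, absurd rfl hxy]

theorem norm_sum_mul_star_le_one {a b : κ → ℂ} (ha : ∑ k, ‖a k‖ ^ 2 = 1)
    (hb : ∑ k, ‖b k‖ ^ 2 = 1) : ‖∑ k, a k * star (b k)‖ ≤ 1 :=
  calc ‖∑ k, a k * star (b k)‖ ≤ ∑ k, ‖a k * star (b k)‖ := norm_sum_le _ _
    _ ≤ ∑ k, (‖a k‖ ^ 2 + ‖b k‖ ^ 2) / 2 := Finset.sum_le_sum fun k _ => by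
        rw [norm_mul, norm_star]; nlinarith [sq_nonneg (‖a k‖ - ‖b k‖)]
    _ = 1 := by rw [← Finset.sum_div, Finset.sum_add_distrib, ha, hb]; norm_num

theorem sum_norm_sq_diagonal {d : κ → Bit → ℂ}
    (hd : ∑ k, (Matrix.diagonal (d k))ᴴ * Matrix.diagonal (d k) = 1) (x : Bit) :
    ∑ k, ‖d k x‖ ^ 2 = 1 := by
  have h := congrFun (congrFun hd x) x
  simp only [Matrix.sum_apply, Matrix.diagonal_conjTranspose, Matrix.diagonal_mul_diagonal,
    Matrix.diagonal_apply_eq, Matrix.one_apply_eq, Pi.star_apply, Complex.star_def,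
    Complex.conj_mul'] at h
  exact_mod_cast h

theorem sum_conjBy_diagonal {d : κ → Bit → ℂ} (hd : ∀ x, ∑ k, ‖d k x‖ ^ 2 = 1) :
    ∑ k, conjBy (Matrix.diagonal (d k)) = dephasing (∑ k, d k 0 * star (d k 1)) := by
  have hone (x : Bit) : ∑ k, d k x * star (d k x) = 1 := by
    simp only [Complex.star_def, Complex.mul_conj']
    exact_mod_cast hd x
  ext ρ x y : 3
  rw [LinearMap.sum_apply, Matrix.sum_apply, dephasing_apply]
  simp only [conjBy_diagonal_apply, ← Finset.sum_mul]
  congr 1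
  rcases x.eq_zero_or_one with rfl | rfl <;> rcases y.eq_zero_or_one with rfl | rfl
  · rw [hone, dephFactor_self]
  · rw [dephFactor_zero_one]
  · simp only [dephFactor_one_zero, star_sum, star_mul', star_star, mul_comm]
  · rw [hone, dephFactor_self]

end Kraus

theorem exists_eq_dephasing_of_isChannel {N : SuperOp1} (h : IsChannel N)
    (hZ : ptmEntry N Pauli.Z.mat Pauli.Z.mat = 1) : ∃ μ : ℂ, ‖μ‖ ≤ 1 ∧ N = dephasing μ := by
  obtain ⟨r, E, hE, rfl⟩ := h
  obtain ⟨d, rfl⟩ : ∃ d : Fin r → Bit → ℂ, E = fun k => Matrix.diagonal (d k) :=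
    ⟨fun k => (E k).diag,
      funext fun k => (kraus_isDiag_of_ptmEntry_Z_eq_one hE hZ k).diagonal_diag.symm⟩
  have hd := sum_norm_sq_diagonal hE
  exact ⟨_, norm_sum_mul_star_le_one (hd 0) (hd 1), sum_conjBy_diagonal hd⟩

/-! ### Pauli transfer matrices of dephasing maps -/

/-- The Pauli transfer matrix of dephasing with coherence `μ`, bundled as a homomorphism in `μ`. -/
noncomputable def dephPtm : ℂ →* Matrix Pauli Pauli ℂ where
  toFun μ := Matrix.of fun P P' => match P, P' with
    | .I, .I => 1
    | .Z, .Z => 1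
    | .X, .X => (μ.re : ℂ)
    | .X, .Y => (μ.im : ℂ)
    | .Y, .X => -(μ.im : ℂ)
    | .Y, .Y => (μ.re : ℂ)
    | _, _ => 0
  map_one' := by
    ext P P'
    cases P <;> cases P' <;> simp
  map_mul' μ ν := by
    ext P P'
    rw [Matrix.mul_apply, sum_pauli]
    cases P <;> cases P' <;> simp <;> ring

theorem dephPtm_X_X (μ : ℂ) : dephPtm μ .X .X = μ.re := rfl

theorem ptm_dephasing (μ : ℂ) : ptm (dephasing μ) = dephPtm μ := by
  ext P P'
  rw [ptm, Matrix.of_apply, ptmEntry]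
  simp only [Matrix.trace, sum_bit, Matrix.diag_apply, Matrix.mul_apply,
    Matrix.conjTranspose_apply, dephasing_apply]
  cases P <;> cases P' <;> simp [Pauli.mat, dephPtm, Complex.ext_iff]

section DephMatrix

variable {Q : Type} [Fintype Q]

/-- The entrywise multiplier of independent dephasing with coherence `ν i` on each qubit `i`. -/
def dephMatrix (ν : Q → ℂ) : Op Q := Matrix.of fun x y => ∏ i, dephFactor (x i) (y i) (ν i)

theorem dephMatrix_apply (ν : Q → ℂ) (x y : Q → Bit) :
    dephMatrix ν x y = ∏ i, dephFactor (x i) (y i) (ν i) := rfl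

theorem dephMatrix_one_hadamard (ρ : Op Q) : dephMatrix 1 ⊙ ρ = ρ := by
  ext x y; simp [dephMatrix_apply]

theorem dephMatrix_mul (ν ν' : Q → ℂ) : dephMatrix (ν * ν') = dephMatrix ν ⊙ dephMatrix ν' := by
  ext x y
  simp only [Matrix.hadamard_apply, dephMatrix_apply, Pi.mul_apply, map_mul,
    Finset.prod_mul_distrib]

theorem sum_frameConj_dephMatrix [DecidableEq Q] (ν : Q → ℂ) :
    ∑ e, (1 / 2 : ℂ) ^ Fintype.card Q • frameConj e 0 (dephMatrix ν) =
      dephMatrix fun i => ((ν i).re : ℂ) := by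
  ext x y
  rw [Matrix.sum_apply]
  simp only [Matrix.smul_apply, smul_eq_mul, frameConj_apply, zero_dotProduct, sgn_zero, one_mul,
    dephMatrix_apply, Pi.add_apply, ← Finset.mul_sum]
  rw [← Fintype.prod_sum fun i c => dephFactor (x i + c) (y i + c) (ν i)]
  simp only [sum_dephFactor_add, Finset.prod_mul_distrib, Finset.prod_const, Finset.card_univ]
  rw [← mul_assoc, ← mul_pow]
  norm_num

end DephMatrix

/-! ### The foliation circuit with dephasing noise -/

section Circuit

variable {Q : Type} [DecidableEq Q]

theorem onQubit_dephasing_apply (v : Q) (μ : ℂ) (ρ : Op Q) (a b : Q → Bit) :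
    onQubit v (dephasing μ) ρ a b = dephFactor (a v) (b v) μ * ρ a b := by
  rw [onQubit, Matrix.of_apply, Finset.sum_eq_single (a v), Finset.sum_eq_single (b v)]
  · simp [dephasing_apply]
  · intro y _ hy; simp [dephasing_apply, hy]
  · simp
  · intro x _ hx; simp [dephasing_apply, hx]
  · simp

theorem runCircuit_append (c c' : List (Instr Q)) (ρ : Op Q) :
    runCircuit (c ++ c') ρ = runCircuit c' (runCircuit c ρ) := List.foldl_append

theorem runCircuit_flatMap_apply {ι : Type*} (l : List ι) {f : ι → List (Instr Q)} {F : ι → ℂ}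
    {a b : Q → Bit} (h : ∀ i ρ, runCircuit (f i) ρ a b = F i * ρ a b) (ρ : Op Q) :
    runCircuit (l.flatMap f) ρ a b = (l.map F).prod * ρ a b := by
  induction l generalizing ρ with
  | nil => simp [runCircuit]
  | cons i l ih =>
    rw [List.flatMap_cons, runCircuit_append, ih, h, List.map_cons, List.prod_cons]
    ring

theorem runCircuit_map_apply {ι : Type*} (l : List ι) {f : ι → Instr Q} {F : ι → ℂ}
    {a b : Q → Bit} (h : ∀ i ρ, (f i).apply ρ a b = F i * ρ a b) (ρ : Op Q) :
    runCircuit (l.map f) ρ a b = (l.map F).prod * ρ a b := by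
  rw [List.map_eq_flatMap]
  exact runCircuit_flatMap_apply l h ρ

end Circuit

section Layer

variable {n : ℕ} {C : CSSCode n} {L : ℕ}

/-- The parities of a binary vector on the supports of the generators of kind `b`, as a
homomorphism. -/
def CSSCode.parity (C : CSSCode n) (b : Kind) : (Fin n → Bit) →+ (Fin (C.num b) → Bit) where
  toFun x a := ∑ i ∈ C.supp b a, x i
  map_zero' := by ext a; simp
  map_add' x y := by ext a; simp [Finset.sum_add_distrib]

theorem CSSCode.parity_apply (C : CSSCode n) (b : Kind) (x : Fin n → Bit) (a : Fin (C.num b)) :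
    C.parity b x a = ∑ i ∈ C.supp b a, x i := rfl

theorem Schedule.prod_map_seq {M : Type*} [CommMonoid M] (S : Schedule C L) (k : Fin L) (b : Kind)
    (F : Fin (C.num b) → Fin n → M) :
    ((S.seq k b).map fun x => F x.1 x.2).prod = ∏ a, ∏ i ∈ C.supp b a, F a i := by
  rw [← List.prod_toFinset _ (S.nodup k b), Finset.prod_sigma']
  refine Finset.prod_bij' (fun x _ => ⟨x.1, x.2⟩) (fun x _ => (x.1, x.2)) ?_ ?_ ?_ ?_ ?_ <;>
    simp [S.mem_iff]

/-- The product of the coherences at the locations of the code qubit `i` of layer `(k, b)` within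
that layer, that is, without the location after the gate with its successor. -/
noncomputable def layerCoherence (μ : Loc C → ℂ) (k : ℕ) (b : Kind) (i : Fin n) : ℂ :=
  μ (.codePrep k b i) * μ (.codeIn k b i) * ∏ a with i ∈ C.supp b a, μ (.codeStab k b a i)

/-- The product of the coherences at the locations of an ancilla. -/
noncomputable def ancCoherence (μ : Loc C → ℂ) (k : ℕ) (b : Kind) (a : Fin (C.num b)) : ℂ :=
  μ (.ancPrep k b a) * ∏ i ∈ C.supp b a, μ (.ancStab k b a i)

/-- The coherence at the last location of the qubit from which code qubit `i` is teleported in layer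
`(k, b)`. The input qubits carry no noise; neither does the output of the last layer, which is the
case `k = L`, where there is no layer any more. -/
noncomputable def outCoherence (L : ℕ) (μ : Loc C → ℂ) (k : ℕ) : Kind → Fin n → ℂ
  | .X, i => if k = 0 ∨ k = L then 1 else μ (.codeOut (k - 1) .Z i)
  | .Z, i => μ (.codeOut k .X i)

theorem outNoise_dephasing (μ : Loc C → ℂ) (k : Fin L) (b : Kind) (i : Fin n) :
    outNoise (fun l => dephasing (μ l)) k b i = dephasing (outCoherence L μ k b i) := by
  cases b
  · simp only [outNoise, outCoherence, k.2.ne, or_false]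
    split_ifs
    · exact dephasing_one.symm
    · rfl
  · rfl

theorem runCircuit_layerCircuit_apply (S : Schedule C L) (μ : Loc C → ℂ) (k : Fin L) (b : Kind)
    (ρ : Op (Wire n (C.num b))) (u v x y : Fin n → Bit) (c d : Fin (C.num b) → Bit) :
    runCircuit (layerCircuit S (fun l => dephasing (μ l)) k b) ρ
        (Sum.elim u (Sum.elim x c)) (Sum.elim v (Sum.elim y d)) =
      (∏ i, sgn (u i * x i) * sgn (v i * y i)) * dephMatrix (outCoherence L μ k b) u v *
        dephMatrix (layerCoherence μ k b) x y *
        (∏ a, sgn (c a * C.parity b x a) * sgn (d a * C.parity b y a)) *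
        dephMatrix (ancCoherence μ k b) c d *
        ρ (Sum.elim u (Sum.elim x c)) (Sum.elim v (Sum.elim y d)) := by
  have hswap : ∏ a, ∏ i ∈ C.supp b a, dephFactor (x i) (y i) (μ (.codeStab k b a i)) =
      ∏ i, ∏ a with i ∈ C.supp b a, dephFactor (x i) (y i) (μ (.codeStab k b a i)) :=
    Finset.prod_comm' (by simp)
  simp only [layerCircuit, runCircuit_append, outNoise_dephasing]
  rw [runCircuit_flatMap_apply _ (F := fun z : Fin (C.num b) × Fin n =>
      sgn (c z.1 * x z.2) * sgn (d z.1 * y z.2) *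
        dephFactor (c z.1) (d z.1) (μ (.ancStab k b z.1 z.2)) *
        dephFactor (x z.2) (y z.2) (μ (.codeStab k b z.1 z.2))),
    runCircuit_flatMap_apply _ (F := fun i => sgn (u i * x i) * sgn (v i * y i) *
      dephFactor (u i) (v i) (outCoherence L μ k b i) * dephFactor (x i) (y i) (μ (.codeIn k b i))),
    runCircuit_map_apply _ (F := fun a => dephFactor (c a) (d a) (μ (.ancPrep k b a))),
    runCircuit_map_apply _ (F := fun i => dephFactor (x i) (y i) (μ (.codePrep k b i))),
    S.prod_map_seq k b fun a i => sgn (c a * x i) * sgn (d a * y i) *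
        dephFactor (c a) (d a) (μ (.ancStab k b a i)) *
        dephFactor (x i) (y i) (μ (.codeStab k b a i))]
  · simp only [← Fin.prod_univ_def, dephMatrix_apply, layerCoherence, ancCoherence, map_mul,
      map_prod, Finset.prod_mul_distrib, C.parity_apply, Finset.mul_sum, sgn_sum, hswap]
    ring
  all_goals
    intro i ρ
    simp only [runCircuit, List.foldl_cons, List.foldl_nil, Instr.apply, onQubit_dephasing_apply,
      applyCZ, Matrix.of_apply, Sum.elim_inl, Sum.elim_inr]
    try ring

/-- The factor by which measuring an ancilla with coherence `ν` multiplies a matrix entry, where `α`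
and `β` are the sums of the reported outcome and the actual parities of the two basis states. -/
noncomputable def readout (ν : ℂ) (α β : Bit) : ℂ :=
  ∑ c, ∑ d, 1 / 4 * (sgn (α * c) * sgn (β * d) * dephFactor c d ν)

/-- The entrywise multiplier of the measurement of all generators of kind `b` by ancillas with
coherences `ν` and outcomes `s`. -/
noncomputable def readoutMatrix (C : CSSCode n) (b : Kind) (ν : Fin (C.num b) → ℂ)
    (s : Fin (C.num b) → Bit) : Op (Fin n) :=
  Matrix.of fun x y => ∏ a, readout (ν a) ((s + C.parity b x) a) ((s + C.parity b y) a)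

theorem readoutMatrix_apply (b : Kind) (ν : Fin (C.num b) → ℂ) (s : Fin (C.num b) → Bit)
    (x y : Fin n → Bit) : readoutMatrix C b ν s x y =
      (1 / 4) ^ C.num b * ∑ c, ∑ d, (∏ a, sgn (s a * c a) * sgn (s a * d a)) *
        (∏ a, sgn (c a * C.parity b x a) * sgn (d a * C.parity b y a)) * dephMatrix ν c d := by
  simp only [readoutMatrix, Matrix.of_apply, readout, Fintype.prod_sum, dephMatrix_apply,
    Finset.mul_sum, Pi.add_apply, add_mul, sgn_add, Finset.prod_mul_distrib, Finset.prod_const,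
    Finset.card_univ, Fintype.card_fin]
  refine Finset.sum_congr rfl fun c _ => Finset.sum_congr rfl fun d _ => ?_
  simp only [mul_comm (c _) (C.parity _ _ _), mul_comm (d _) (C.parity _ _ _)]
  ring

theorem layer_dephasing (S : Schedule C L) (μ : Loc C → ℂ) (k : Fin L) (b : Kind)
    (m : Fin n → Bit) (s : Fin (C.num b) → Bit) (ρ : Op (Fin n)) :
    layer S (fun l => dephasing (μ l)) k b m s ρ = (1 / 2 : ℂ) ^ n •
      (dephMatrix (layerCoherence μ k b) ⊙ readoutMatrix C b (ancCoherence μ k b) s ⊙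
        frameConj m 0 (hadConj (dephMatrix (outCoherence L μ k b) ⊙ ρ))) := by
  ext x y
  simp only [layer, measureX, Matrix.of_apply, runCircuit_layerCircuit_apply, prepare,
    Sum.elim_inl, Matrix.smul_apply, smul_eq_mul, Matrix.hadamard_apply, frameConj_apply,
    zero_dotProduct, sgn_zero, one_mul, hadConj_apply, readoutMatrix_apply, Fintype.card_fin]
  have hreg (A B D E : ℂ) (g : (Fin n → Bit) → (Fin n → Bit) → ℂ)
      (h : (Fin (C.num b) → Bit) → (Fin (C.num b) → Bit) → ℂ) :
      A * (B * (D * ∑ c, ∑ d, h c d) * (E * ∑ u, ∑ v, g u v)) =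
        ∑ u, ∑ v, ∑ c, ∑ d, A * (B * (D * h c d) * (E * g u v)) := by
    simp only [Finset.mul_sum, Finset.sum_mul]
  rw [hreg]
  refine Finset.sum_congr rfl fun u _ => Finset.sum_congr rfl fun v _ =>
    Finset.sum_congr rfl fun c _ => Finset.sum_congr rfl fun d _ => ?_
  simp only [sgn_dotProduct, Pi.add_apply, add_mul, sgn_add, Finset.prod_mul_distrib,
    Finset.prod_div_distrib, Finset.prod_const, Finset.card_univ, Fintype.card_fin, pow_add,
    mul_comm (x _), mul_comm (y _)]
  simp only [div_eq_mul_inv, one_mul, inv_pow]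
  rw [show (4 : ℂ) = 2 * 2 by norm_num, mul_pow]
  ring

theorem outNoise_congr {N N' : Loc C → SuperOp1} (h : ∀ l : Loc C, l.Occurs L → N l = N' l)
    (k : Fin L) (b : Kind) (i : Fin n) : outNoise N k b i = outNoise N' k b i := by
  cases b
  · simp only [outNoise]
    split_ifs with hk
    · rfl
    · refine h _ ⟨?_, ?_⟩
      · simp only [Loc.site, Site.round]; omega
      · have : ¬ k.val - 1 + 1 = L := by omega
        simp [Loc.site, Site.locs, this]
  · exact h _ ⟨k.2, by simp [Loc.site, Site.locs]⟩

theorem layerCircuit_congr (S : Schedule C L) {N N' : Loc C → SuperOp1}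
    (h : ∀ l : Loc C, l.Occurs L → N l = N' l) (k : Fin L) (b : Kind) :
    layerCircuit S N k b = layerCircuit S N' k b := by
  have hprep (i : Fin n) : N (.codePrep k b i) = N' (.codePrep k b i) :=
    h _ ⟨k.2, by simp [Loc.site, Site.locs]⟩
  have hin (i : Fin n) : N (.codeIn k b i) = N' (.codeIn k b i) :=
    h _ ⟨k.2, by simp [Loc.site, Site.locs]⟩
  have hanc (a : Fin (C.num b)) : N (.ancPrep k b a) = N' (.ancPrep k b a) :=
    h _ ⟨k.2, by simp [Loc.site, Site.locs]⟩
  simp only [layerCircuit, hprep, hin, hanc, outNoise_congr h]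
  congr 1
  refine List.flatMap_congr fun x hx => ?_
  have hmem := (S.mem_iff k b x).1 hx
  rw [h (.ancStab k b x.1 x.2) ⟨k.2, by simp [Loc.site, Site.locs, hmem]⟩,
    h (.codeStab k b x.1 x.2) ⟨k.2, by simp [Loc.site, Site.locs, hmem]⟩]

theorem foliationOutput_congr (S : Schedule C L) {N N' : Loc C → SuperOp1}
    (h : ∀ l : Loc C, l.Occurs L → N l = N' l) (σ : StabOutcomes C L) (ρ : Op (Fin n)) :
    foliationOutput S N σ ρ = foliationOutput S N' σ ρ := by
  simp only [foliationOutput, foliate, layer, layerCircuit_congr S h]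

end Layer

/-! ### The Pauli frame -/

section PartialSums

variable {A : Type*} {L : ℕ}

theorem eq_partialSum_iff [AddMonoid A] {F : Fin (L + 1) → A} {d : Fin L → A} :
    F = Fin.partialSum d ↔ F 0 = 0 ∧ ∀ k : Fin L, F k.succ = F k.castSucc + d k := by
  constructor
  · rintro rfl
    exact ⟨Fin.partialSum_zero d, Fin.partialSum_succ d⟩
  · rintro ⟨h0, hsucc⟩
    ext k
    induction k using Fin.induction with
    | zero => rw [h0, Fin.partialSum_zero]
    | succ k ih => rw [hsucc, ih, Fin.partialSum_succ]

theorem partialSum_eq_sum [AddCommMonoid A] (d : Fin L → A) :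
    Fin.partialSum d = fun k => ∑ j with j.castSucc < k, d j := by
  refine (eq_partialSum_iff.2 ⟨by simp, fun k => ?_⟩).symm
  have : Finset.univ.filter (fun j : Fin L => j.castSucc < k.succ) =
      insert k (Finset.univ.filter fun j : Fin L => j.castSucc < k.castSucc) := by
    ext j; simp [le_iff_eq_or_lt]
  rw [this, Finset.sum_insert (by simp), add_comm]

theorem cons_zero_partialSum_succ [AddMonoid A] (d : Fin L → A) :
    (Fin.cons 0 fun k => Fin.partialSum d k.succ : Fin (L + 1) → A) = Fin.partialSum d :=
  funext (Fin.cases (Fin.partialSum_zero d).symm fun _ => rfl)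

/-- A sequence is determined by its nonempty partial sums; the inverse takes differences of
consecutive entries. -/
def partialSumEquiv (A : Type*) [AddCommGroup A] (L : ℕ) : (Fin L → A) ≃ (Fin L → A) where
  toFun d k := Fin.partialSum d k.succ
  invFun f k := f k - (Fin.cons 0 f : Fin (L + 1) → A) k.castSucc
  left_inv d := by
    ext k
    dsimp only
    rw [cons_zero_partialSum_succ, Fin.partialSum_succ, add_sub_cancel_left]
  right_inv f := by
    have : Fin.cons 0 f =
        Fin.partialSum fun k => f k - (Fin.cons 0 f : Fin (L + 1) → A) k.castSucc :=
      eq_partialSum_iff.2 ⟨rfl, fun k => (add_sub_cancel _ _).symm⟩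
    ext k
    dsimp only
    rw [← this, Fin.cons_succ]

end PartialSums

section Folds

theorem foldl_finRange_rel {α β : Type*} {L : ℕ} {f : α → Fin L → α} {g : β → Fin L → β}
    {a : α} {b : β} (R : Fin (L + 1) → α → β → Prop) (h0 : R 0 a b)
    (hstep : ∀ k a b, R k.castSucc a b → R k.succ (f a k) (g b k)) :
    R (Fin.last L) ((List.finRange L).foldl f a) ((List.finRange L).foldl g b) := by
  induction L with
  | zero => simpa using h0
  | succ L ih =>
    rw [List.finRange_succ_last, List.foldl_append, List.foldl_append, List.foldl_map,
      List.foldl_map]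
    exact hstep (Fin.last L) _ _ (ih (fun k => R k.castSucc) h0 fun k => hstep k.castSucc)

variable {A V H : Type*} [Fintype A] [AddCommMonoid V] [FunLike H V V] [AddMonoidHomClass H V V]

theorem sum_foldl_finRange {L : ℕ} (B : Fin L → A → H) (v : V) :
    ∑ g : Fin L → A, (List.finRange L).foldl (fun v k => B k (g k) v) v =
      (List.finRange L).foldl (fun v k => ∑ a, B k a v) v := by
  induction L with
  | zero => simp
  | succ L ih =>
    rw [List.finRange_succ_last, List.foldl_append, List.foldl_map, ← ih,
      ← Equiv.sum_comp (Fin.snocEquiv fun _ => A), Fintype.sum_prod_type]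
    simp only [List.foldl_append, List.foldl_map, List.foldl_cons, List.foldl_nil, Fin.snocEquiv,
      Equiv.coe_fn_mk, Fin.snoc_last, Fin.snoc_castSucc, map_sum]

/-- Functions on the two kinds are pairs. -/
def kindPiEquiv (A : Type*) : (Kind → A) ≃ A × A where
  toFun h := (h .X, h .Z)
  invFun p b := match b with | .X => p.1 | .Z => p.2
  left_inv h := by ext b; cases b <;> rfl
  right_inv _ := rfl

theorem sum_kind_comp (B : Kind → A → H) (v : V) :
    ∑ h : Kind → A, B .Z (h .Z) (B .X (h .X) v) = ∑ c, B .Z c (∑ a, B .X a v) := by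
  rw [← Equiv.sum_comp (kindPiEquiv A).symm, Fintype.sum_prod_type, Finset.sum_comm]
  simp only [kindPiEquiv, Equiv.coe_fn_symm_mk, map_sum]

end Folds

section Frame

variable {n : ℕ} {C : CSSCode n} {L : ℕ}

/-- The product of the coherences at all locations of a physical qubit. -/
noncomputable def siteCoherence (L : ℕ) (μ : Loc C → ℂ) (γ : Site C) : ℂ :=
  ((γ.locs L).map μ).prod

theorem prod_map_filter_finRange {M : Type*} [CommMonoid M] {r : ℕ} (p : Fin r → Prop)
    [DecidablePred p] (f : Fin r → M) :
    (((List.finRange r).filter fun i => p i).map f).prod = ∏ i with p i, f i := by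
  rw [← List.prod_toFinset _ ((List.nodup_finRange r).filter _), List.toFinset_filter,
    List.toFinset_finRange]
  simp

theorem siteCoherence_anc (μ : Loc C → ℂ) (k : ℕ) (b : Kind) (a : Fin (C.num b)) :
    siteCoherence L μ (.anc k b a) = ancCoherence μ k b a := by
  simp only [siteCoherence, Site.locs, ancCoherence, List.map_cons, List.prod_cons, List.map_map,
    Function.comp_def]
  rw [prod_map_filter_finRange, Finset.filter_univ_mem]

theorem siteCoherence_code_X (μ : Loc C → ℂ) (k : ℕ) (i : Fin n) :
    siteCoherence L μ (.code k .X i) = layerCoherence μ k .X i * outCoherence L μ k .Z i := by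
  simp [siteCoherence, Site.locs, layerCoherence, outCoherence, Function.comp_def,
    prod_map_filter_finRange, mul_assoc]

theorem siteCoherence_code_Z (μ : Loc C → ℂ) (k : ℕ) (i : Fin n) :
    siteCoherence L μ (.code k .Z i) =
      layerCoherence μ k .Z i * outCoherence L μ (k + 1) .X i := by
  by_cases hk : k + 1 = L <;>
    simp [siteCoherence, Site.locs, layerCoherence, outCoherence, Function.comp_def,
      prod_map_filter_finRange, mul_assoc, hk]

theorem frameConj_readoutMatrix (b : Kind) (ν : Fin (C.num b) → ℂ) (s : Fin (C.num b) → Bit)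
    (f : Fin n → Bit) :
    frameConj f 0 (readoutMatrix C b ν s) = readoutMatrix C b ν (s + C.parity b f) := by
  ext x y
  simp only [frameConj_apply, zero_dotProduct, sgn_zero, one_mul, readoutMatrix, Matrix.of_apply,
    map_add]
  simp only [add_assoc, add_comm (C.parity b f)]

/-- A layer in the Pauli frame, where `g` is the part of the frame that affects the noise. -/
noncomputable def frameLayer (L : ℕ) (μ : Loc C → ℂ) (k : ℕ) (b : Kind)
    (s : Fin (C.num b) → Bit) (g : Fin n → Bit) : Op (Fin n) →ₗ[ℂ] Op (Fin n) :=
  (1 / 2 : ℂ) ^ n • schurMul (frameConj g 0 (dephMatrix fun i => siteCoherence L μ (.code k b i)) ⊙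
    readoutMatrix C b (ancCoherence μ k b) s) ∘ₗ hadConj.toAlgEquiv.toLinearMap

theorem frameLayer_apply (μ : Loc C → ℂ) (k : ℕ) (b : Kind) (s : Fin (C.num b) → Bit)
    (g : Fin n → Bit) (ρ : Op (Fin n)) : frameLayer L μ k b s g ρ =
      (1 / 2 : ℂ) ^ n • (frameConj g 0 (dephMatrix fun i => siteCoherence L μ (.code k b i)) ⊙
        readoutMatrix C b (ancCoherence μ k b) s ⊙ hadConj ρ) := rfl

theorem dephMatrix_hadamard_layer (S : Schedule C L) (μ : Loc C → ℂ) (k : Fin L) (b : Kind)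
    (m f g : Fin n → Bit) (s : Fin (C.num b) → Bit) {next : Fin n → ℂ} {ρ τ : Op (Fin n)}
    (hnext : ∀ i, siteCoherence L μ (.code k b i) = layerCoherence μ k b i * next i)
    (h : dephMatrix (outCoherence L μ k b) ⊙ ρ = frameConj f g τ) :
    dephMatrix next ⊙
        layer S (fun l => dephasing (μ l)) k b m (s + C.parity b (g + m)) ρ =
      frameConj (g + m) f (frameLayer L μ k b s (g + m) τ) := by
  have hdeph : dephMatrix (fun i => siteCoherence L μ (.code k b i)) =
      dephMatrix (layerCoherence μ k b) ⊙ dephMatrix next := by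
    rw [← dephMatrix_mul]
    exact congrArg dephMatrix (funext hnext)
  rw [layer_dephasing, h, hadConj_frameConj, frameConj_frameConj, frameLayer_apply, frameConj_smul,
    frameConj_hadamard, frameConj_hadamard, frameConj_readoutMatrix, frameConj_frameConj,
    vec_add_self, add_zero, frameConj_zero_zero, hdeph, zero_add, add_comm m, Matrix.hadamard_smul]
  congr 1
  simp only [← Matrix.hadamard_assoc]
  rw [Matrix.hadamard_comm (dephMatrix next)]

theorem pauliFrame_eq (m : TeleOutcomes n L) :
    pauliFrame m = pauliOp .X ((∑ k, m k) .Z) * pauliOp .Z ((∑ k, m k) .X) := by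
  rw [pauliFrame]
  congr <;> ext i <;> simp only [Finset.sum_apply]

theorem partialSum_last {A : Type*} [AddCommMonoid A] (d : Fin L → A) :
    Fin.partialSum d (Fin.last L) = ∑ k, d k := by
  simp [partialSum_eq_sum, Fin.castSucc_lt_last]

theorem foliate_dephasing (S : Schedule C L) (μ : Loc C → ℂ) (m : TeleOutcomes n L)
    (t : StabOutcomes C L) (ρ : Op (Fin n)) :
    foliate S (fun l => dephasing (μ l)) m
        (fun k b => t k b + C.parity b (Fin.partialSum m k.succ b)) ρ =
      frameConj ((∑ k, m k) .Z) ((∑ k, m k) .X) ((List.finRange L).foldl (fun ρ (k : Fin L) =>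
        frameLayer L μ k .Z (t k .Z) (Fin.partialSum m k.succ .Z)
          (frameLayer L μ k .X (t k .X) (Fin.partialSum m k.succ .X) ρ)) ρ) := by
  have hone (k : ℕ) (hk : k = 0 ∨ k = L) (ρ : Op (Fin n)) :
      dephMatrix (outCoherence L μ k .X) ⊙ ρ = ρ := by
    rw [show outCoherence L μ k .X = 1 from funext fun i => if_pos hk, dephMatrix_one_hadamard]
  have key := foldl_finRange_rel (a := ρ) (b := ρ)
    (f := fun ρ k => layer S (fun l => dephasing (μ l)) k .Z (m k .Z)
      (t k .Z + C.parity .Z (Fin.partialSum m k.succ .Z))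
      (layer S (fun l => dephasing (μ l)) k .X (m k .X)
        (t k .X + C.parity .X (Fin.partialSum m k.succ .X)) ρ))
    (g := fun ρ k => frameLayer L μ k .Z (t k .Z) (Fin.partialSum m k.succ .Z)
      (frameLayer L μ k .X (t k .X) (Fin.partialSum m k.succ .X) ρ))
    (fun k ρ τ => dephMatrix (outCoherence L μ k .X) ⊙ ρ =
      frameConj (Fin.partialSum m k .Z) (Fin.partialSum m k .X) τ) ?_ fun k ρ τ h => ?_
  · rw [Fin.val_last, hone L (.inr rfl), partialSum_last] at key
    exact key
  · rw [Fin.val_zero, hone 0 (.inl rfl), Fin.partialSum_zero]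
    exact (frameConj_zero_zero ρ).symm
  · rw [Fin.partialSum_succ]
    exact dephMatrix_hadamard_layer S μ k .Z _ _ _ _ (siteCoherence_code_Z μ k)
      (dephMatrix_hadamard_layer S μ k .X _ _ _ _ (siteCoherence_code_X μ k) h)

theorem frameSyndrome_eq_partialSum (σ : StabOutcomes C L) :
    frameSyndrome σ = fun k => Fin.partialSum σ k.succ := by
  ext k b a
  simp [frameSyndrome, partialSum_eq_sum, Finset.sum_apply, Fin.castSucc_lt_succ_iff,
    Finset.filter_ge_eq_Iic]

theorem clusterSyndrome_eq_iff (m : TeleOutcomes n L) (s σ : StabOutcomes C L) :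
    clusterSyndrome m s = σ ↔
      s = fun k b => frameSyndrome σ k b + C.parity b (Fin.partialSum m k.succ b) := by
  let p : StabOutcomes C L := fun k b => C.parity b (m k b)
  have hsum : (fun k b => frameSyndrome σ k b + C.parity b (Fin.partialSum m k.succ b)) =
      partialSumEquiv _ L (σ + p) := by
    funext k b
    rw [frameSyndrome_eq_partialSum]
    simp only [partialSumEquiv, Equiv.coe_fn_mk, partialSum_eq_sum, Finset.sum_apply, map_sum,
      Pi.add_apply, Finset.sum_add_distrib, p]
  have hprev (k : Fin L) (b : Kind) (a : Fin (C.num b)) :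
      (Fin.cons 0 s : Fin (L + 1) → (b : Kind) → Fin (C.num b) → Bit) k.castSucc b a =
        if 0 < k.val then s ⟨k.val - 1, by omega⟩ b a else 0 := by
    obtain ⟨_ | k, hk⟩ := k <;> rfl
  have hbit (x y z w : Bit) : x + y + z = w ↔ x - y = w + z := by revert x y z w; decide
  rw [hsum, ← Equiv.symm_apply_eq]
  simp only [funext_iff, clusterSyndrome, partialSumEquiv, Equiv.coe_fn_symm_mk, Pi.sub_apply,
    Pi.add_apply, hprev, p, C.parity_apply, hbit]

theorem foliationOutput_dephasing (S : Schedule C L) (μ : Loc C → ℂ) (σ : StabOutcomes C L)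
    (ρ : Op (Fin n)) :
    foliationOutput S (fun l => dephasing (μ l)) σ ρ =
      ∑ g : TeleOutcomes n L, (List.finRange L).foldl (fun ρ (k : Fin L) =>
        frameLayer L μ k .Z (frameSyndrome σ k .Z) (g k .Z)
          (frameLayer L μ k .X (frameSyndrome σ k .X) (g k .X) ρ)) ρ := by
  rw [← Equiv.sum_comp (partialSumEquiv _ L), foliationOutput]
  refine Finset.sum_congr rfl fun m _ => ?_
  simp only [clusterSyndrome_eq_iff, Finset.sum_ite_eq', Finset.mem_univ, if_true]
  rw [foliate_dephasing, pauliFrame_eq, conjTranspose_mul_frameConj_mul]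
  rfl

/-- A layer in the Pauli frame, summed over the outcomes of the teleportations. -/
noncomputable def meanLayer (L : ℕ) (μ : Loc C → ℂ) (k : ℕ) (b : Kind)
    (s : Fin (C.num b) → Bit) (ρ : Op (Fin n)) : Op (Fin n) :=
  dephMatrix (fun i => ((siteCoherence L μ (.code k b i)).re : ℂ)) ⊙
    readoutMatrix C b (ancCoherence μ k b) s ⊙ hadConj ρ

theorem sum_frameLayer (μ : Loc C → ℂ) (k : ℕ) (b : Kind) (s : Fin (C.num b) → Bit)
    (ρ : Op (Fin n)) : ∑ g, frameLayer L μ k b s g ρ = meanLayer L μ k b s ρ := by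
  ext x y
  rw [meanLayer, ← sum_frameConj_dephMatrix]
  simp only [frameLayer_apply, Fintype.card_fin, Matrix.sum_apply, Matrix.smul_apply,
    Matrix.hadamard_apply, smul_eq_mul, Finset.sum_mul, mul_assoc]

theorem foliationOutput_eq_foldl_meanLayer (S : Schedule C L) (μ : Loc C → ℂ)
    (σ : StabOutcomes C L) (ρ : Op (Fin n)) :
    foliationOutput S (fun l => dephasing (μ l)) σ ρ =
      (List.finRange L).foldl (fun ρ (k : Fin L) =>
        meanLayer L μ k .Z (frameSyndrome σ k .Z)
          (meanLayer L μ k .X (frameSyndrome σ k .X) ρ)) ρ := by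
  have hsum := sum_foldl_finRange (fun (k : Fin L) (g : Kind → Fin n → Bit) =>
    frameLayer L μ k .Z (frameSyndrome σ k .Z) (g .Z) ∘ₗ
      frameLayer L μ k .X (frameSyndrome σ k .X) (g .X)) ρ
  have hkind (k : Fin L) (ρ : Op (Fin n)) :=
    sum_kind_comp (fun b => frameLayer L μ k b (frameSyndrome σ k b)) ρ
  simp only [LinearMap.comp_apply, hkind, sum_frameLayer] at hsum
  rw [foliationOutput_dephasing, hsum]

end Frame

/-! ### The code under flips -/

section Commutation

variable {Q : Type} [Fintype Q] [DecidableEq Q]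

theorem pauliOp_conj_pauliOp_conj (b b' : Kind) (e f : Q → Bit) (ρ : Op Q) :
    pauliOp b e * (pauliOp b' f * ρ * (pauliOp b' f)ᴴ) * (pauliOp b e)ᴴ =
      pauliOp b' f * (pauliOp b e * ρ * (pauliOp b e)ᴴ) * (pauliOp b' f)ᴴ := by
  cases b <;> cases b' <;>
    simp only [pauliOp_X_conj_eq_frameConj, pauliOp_Z_conj_eq_frameConj, frameConj_frameConj,
      add_comm e, add_zero, zero_add]

theorem commute_pauliOp_iff {b : Kind} {e : Q → Bit} {ρ : Op Q} :
    Commute (pauliOp b e) ρ ↔ pauliOp b e * ρ * (pauliOp b e)ᴴ = ρ := by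
  rw [pauliOp_conjTranspose, commute_iff_eq]
  constructor <;> intro h
  · rw [h, Matrix.mul_assoc, pauliOp_mul_self, Matrix.mul_one]
  · nth_rw 2 [← h]
    rw [Matrix.mul_assoc _ (pauliOp b e), pauliOp_mul_self, Matrix.mul_one]

theorem commute_pauliOp_conj {b : Kind} {e : Q → Bit} {ρ : Op Q} (h : Commute (pauliOp b e) ρ)
    (b' : Kind) (f : Q → Bit) :
    Commute (pauliOp b e) (pauliOp b' f * ρ * (pauliOp b' f)ᴴ) := by
  rw [commute_pauliOp_iff, pauliOp_conj_pauliOp_conj, commute_pauliOp_iff.1 h]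

theorem commute_pauliOp_self (b : Kind) (e f : Q → Bit) :
    Commute (pauliOp b e) (pauliOp b f) := by
  cases b
  · ext x y
    simp only [pauliOp_X_mul_apply, pauliOp_X_apply, vec_eq_add_iff (x := x + _), add_right_comm]
  · exact Matrix.commute_diagonal _ _

theorem commute_pauliOp_X_Z {e f : Q → Bit} (h : f ⬝ᵥ e = 0) :
    Commute (pauliOp .X e) (pauliOp .Z f) := by
  ext x y
  simp only [pauliOp_X_mul_apply, mul_pauliOp_X_apply, pauliOp_Z_apply, dotProduct_add, h, add_zero,
    vec_eq_add_iff (x := x), eq_comm (a := y)]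

theorem apply_eq_zero_of_commute_pauliOp_Z {e x y : Q → Bit} {ρ : Op Q}
    (h : Commute (pauliOp .Z e) ρ) (hxy : e ⬝ᵥ x ≠ e ⬝ᵥ y) : ρ x y = 0 := by
  have hxy' : sgn (e ⬝ᵥ (x + y)) = -1 := by
    rw [dotProduct_add, (e ⬝ᵥ x + e ⬝ᵥ y).eq_zero_or_one.resolve_left fun h0 =>
      hxy (CharTwo.add_eq_zero.1 h0), sgn_one]
  have hρ := congrFun (congrFun (commute_pauliOp_iff.1 h) x) y
  rw [pauliOp_Z_conj_eq_frameConj, frameConj_apply, hxy', add_zero, add_zero] at hρ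
  linear_combination -hρ / 2

end Commutation

section FlipModel

variable {n : ℕ} {C : CSSCode n} {L : ℕ}

/-- The indicator vector of the support of a generator. -/
def CSSCode.indicator (C : CSSCode n) (b : Kind) (a : Fin (C.num b)) : Fin n → Bit :=
  fun i => if i ∈ C.supp b a then 1 else 0

theorem CSSCode.stab_eq (b : Kind) (a : Fin (C.num b)) :
    C.stab b a = pauliOp b (C.indicator b a) := rfl

theorem CSSCode.indicator_dotProduct (b : Kind) (a : Fin (C.num b)) (x : Fin n → Bit) :
    C.indicator b a ⬝ᵥ x = C.parity b x a := by
  simp [CSSCode.indicator, dotProduct, C.parity_apply]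

theorem CSSCode.commute_stab (b b' : Kind) (a : Fin (C.num b)) (a' : Fin (C.num b')) :
    Commute (C.stab b a) (C.stab b' a') := by
  have hXZ (p : Fin (C.num .X)) (q : Fin (C.num .Z)) : Commute (C.stab .X p) (C.stab .Z q) := by
    refine commute_pauliOp_X_Z ?_
    have hcard : C.indicator .Z q ⬝ᵥ C.indicator .X p = (C.supp .X p ∩ C.supp .Z q).card := by
      rw [C.indicator_dotProduct, C.parity_apply, Finset.inter_comm]
      simp [CSSCode.indicator, Finset.sum_ite_mem]
    exact hcard.trans ((ZMod.natCast_eq_zero_iff_even).2 (C.comm p q))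
  rcases b with _ | _ <;> rcases b' with _ | _
  · exact commute_pauliOp_self _ _ _
  · exact hXZ a a'
  · exact (hXZ a' a).symm
  · exact commute_pauliOp_self _ _ _

theorem CSSCode.commute_stab_projector (b b' : Kind) (a : Fin (C.num b))
    (s : Fin (C.num b') → Bit) : Commute (C.stab b a) (C.projector b' s) := by
  refine Commute.list_prod_right _ _ fun P hP => ?_
  obtain ⟨a', rfl⟩ := List.mem_ofFn.1 hP
  exact ((Commute.one_right _).add_right ((C.commute_stab b b' a a').smul_right _)).smul_right _

theorem CSSCode.stab_conjTranspose (b : Kind) (a : Fin (C.num b)) :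
    (C.stab b a)ᴴ = C.stab b a := pauliOp_conjTranspose _ _

theorem CSSCode.commute_stab_flippedMeasurement {b : Kind} {a : Fin (C.num b)} {ρ : Op (Fin n)}
    (h : Commute (C.stab b a) ρ) (b' : Kind) (q : Fin (C.num b') → ℝ)
    (s : Fin (C.num b') → Bit) : Commute (C.stab b a) (C.flippedMeasurement b' q s ρ) := by
  refine Commute.sum_right _ _ _ fun f _ => Commute.smul_right ?_ _
  have hP := C.commute_stab_projector b b' a (s + f)
  have hP' := hP.star_star
  rw [Matrix.star_eq_conjTranspose, Matrix.star_eq_conjTranspose, C.stab_conjTranspose] at hP'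
  exact (hP.mul_right h).mul_right hP'

theorem CSSCode.commute_stab_flipNoise {b : Kind} {a : Fin (C.num b)} {ρ : Op (Fin n)}
    (h : Commute (C.stab b a) ρ) (b' : Kind) (q : Fin n → ℝ) :
    Commute (C.stab b a) (flipNoise b' q ρ) :=
  Commute.sum_right _ _ _ fun e _ => (commute_pauliOp_conj h b' e).smul_right _

/-- The projector onto the basis states with given parities on the supports of the generators. -/
def parityProjector (C : CSSCode n) (b : Kind) (s : Fin (C.num b) → Bit) : Op (Fin n) :=
  Matrix.diagonal fun x => if s = C.parity b x then 1 else 0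

theorem prod_ofFn_pauliOp_Z (b : Kind) (s : Fin (C.num b) → Bit) :
    (List.ofFn fun a => (1 / 2 : ℂ) • (1 + sgn (s a) • pauliOp .Z (C.indicator b a))).prod =
      parityProjector C b s := by
  have hfactor (a : Fin (C.num b)) :
      (1 / 2 : ℂ) • (1 + sgn (s a) • pauliOp .Z (C.indicator b a)) =
        Matrix.diagonalRingHom (Fin n → Bit) ℂ fun x => if s a = C.parity b x a then 1 else 0 := by
    ext x y
    simp only [Matrix.smul_apply, Matrix.add_apply, pauliOp_Z_apply, Matrix.one_apply,
      C.indicator_dotProduct, Matrix.diagonalRingHom_apply, Matrix.diagonal_apply, smul_eq_mul]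
    generalize s a = α
    generalize C.parity b x a = β
    rcases α.eq_zero_or_one with rfl | rfl <;> rcases β.eq_zero_or_one with rfl | rfl <;>
      split_ifs <;> simp_all <;> norm_num
  have hmap := List.map_ofFn (f := fun a x => if s a = C.parity b x a then (1 : ℂ) else 0)
    (g := Matrix.diagonalRingHom (Fin n → Bit) ℂ)
  simp only [hfactor]
  rw [Function.comp_def] at hmap
  rw [← hmap, ← map_list_prod, List.prod_ofFn, Matrix.diagonalRingHom_apply, parityProjector]
  congr 1
  ext x
  simp [Finset.prod_ite_zero, funext_iff]

theorem CSSCode.projector_Z (s : Fin (C.num .Z) → Bit) :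
    C.projector .Z s = parityProjector C .Z s := prod_ofFn_pauliOp_Z .Z s

theorem CSSCode.hadConj_projector_X (s : Fin (C.num .X) → Bit) :
    hadConj (C.projector .X s) = parityProjector C .X s := by
  rw [CSSCode.projector, map_list_prod, List.map_ofFn, ← prod_ofFn_pauliOp_Z, Function.comp_def]
  simp only [map_smul, map_add, map_one, C.stab_eq, hadConj_pauliOp_X]

/-- The entrywise multiplier of a measurement of the parities on the supports of the generators,
where outcome `a` is flipped with probability `q a` and reported as `s a`. -/
noncomputable def flippedReadoutMatrix (C : CSSCode n) (b : Kind) (q : Fin (C.num b) → ℝ)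
    (s : Fin (C.num b) → Bit) : Op (Fin n) :=
  Matrix.of fun x y =>
    if C.parity b x = C.parity b y then (flipWeight q (s + C.parity b x) : ℂ) else 0

theorem sum_flipWeight_smul_parityProjector (b : Kind) (q : Fin (C.num b) → ℝ)
    (s : Fin (C.num b) → Bit) (ρ : Op (Fin n)) :
    ∑ f, (flipWeight q f : ℂ) •
        (parityProjector C b (s + f) * ρ * (parityProjector C b (s + f))ᴴ) =
      flippedReadoutMatrix C b q s ⊙ ρ := by
  ext x y
  have hf (f : Fin (C.num b) → Bit) (z : Fin n → Bit) :
      s + f = C.parity b z ↔ f = s + C.parity b z := by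
    rw [add_comm s f, eq_comm, vec_eq_add_iff, add_comm s]
  simp only [parityProjector, Matrix.diagonal_conjTranspose, Matrix.sum_apply, Matrix.smul_apply,
    Matrix.mul_diagonal, Matrix.diagonal_mul, Matrix.hadamard_apply, flippedReadoutMatrix,
    Matrix.of_apply, hf]
  rw [Finset.sum_eq_single (s + C.parity b x) (fun f _ hfx => by simp [hfx]) (by simp)]
  split_ifs <;> simp_all

theorem CSSCode.flippedMeasurement_Z (q : Fin (C.num .Z) → ℝ) (s : Fin (C.num .Z) → Bit)
    (ρ : Op (Fin n)) :
    C.flippedMeasurement .Z q s ρ = flippedReadoutMatrix C .Z q s ⊙ ρ := by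
  simp only [CSSCode.flippedMeasurement, C.projector_Z, sum_flipWeight_smul_parityProjector]

theorem CSSCode.hadConj_flippedMeasurement_X (q : Fin (C.num .X) → ℝ) (s : Fin (C.num .X) → Bit)
    (ρ : Op (Fin n)) : hadConj (C.flippedMeasurement .X q s ρ) =
      flippedReadoutMatrix C .X q s ⊙ hadConj ρ := by
  simp only [CSSCode.flippedMeasurement, map_sum, map_smul, map_mul,
    ← Matrix.star_eq_conjTranspose, map_star, C.hadConj_projector_X]
  exact sum_flipWeight_smul_parityProjector .X q s (hadConj ρ)

theorem dephFactor_one_sub_two_mul (p : ℝ) (x y : Bit) :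
    dephFactor x y (1 - 2 * p : ℝ) =
      ∑ c, ((if c = 0 then 1 - p else p : ℝ) : ℂ) * sgn (c * (x + y)) := by
  rw [dephFactor_ofReal, sum_bit]
  rcases (x + y).eq_zero_or_one with h | h
  · simp [CharTwo.add_eq_zero.1 h, CharTwo.add_self_eq_zero]
  · rw [if_neg fun hxy => by simp [hxy, CharTwo.add_self_eq_zero] at h]
    simp [h]; ring

theorem flipNoise_Z (q : Fin n → ℝ) (ρ : Op (Fin n)) :
    flipNoise .Z q ρ = dephMatrix (fun i => ((1 - 2 * q i : ℝ) : ℂ)) ⊙ ρ := by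
  ext x y
  simp only [flipNoise, pauliOp_Z_conj_eq_frameConj, Matrix.sum_apply, Matrix.smul_apply,
    frameConj_apply, Matrix.hadamard_apply, dephMatrix_apply, dephFactor_one_sub_two_mul,
    Fintype.prod_sum, Finset.sum_mul, smul_eq_mul, flipWeight, Complex.ofReal_prod, sgn_dotProduct,
    Pi.add_apply, add_zero, Finset.prod_mul_distrib]
  simp only [mul_assoc]

theorem hadConj_flipNoise_X (q : Fin n → ℝ) (ρ : Op (Fin n)) :
    hadConj (flipNoise .X q ρ) = flipNoise .Z q (hadConj ρ) := by
  simp only [flipNoise, map_sum, map_smul, map_mul, ← Matrix.star_eq_conjTranspose, map_star,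
    hadConj_pauliOp_X]

theorem readout_self {ν : ℂ} {q : ℝ} (h : ν.re = 1 - 2 * q) (α : Bit) :
    readout ν α α = ((if α = 0 then 1 - q else q : ℝ) : ℂ) := by
  have hν : ν + star ν = 2 * (1 - 2 * q) := by
    rw [← starRingEnd_apply, Complex.add_conj, h]; push_cast; ring
  rcases α.eq_zero_or_one with rfl | rfl <;> simp [readout, sum_bit] at hν ⊢
  · linear_combination hν / 4
  · linear_combination -hν / 4

-- The multipliers differ only between basis states of different parities, where `ρ` vanishes.
theorem readoutMatrix_hadamard_eq {b : Kind} {ν : Fin (C.num b) → ℂ} {q : Fin (C.num b) → ℝ}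
    (hν : ∀ a, (ν a).re = 1 - 2 * q a) (s : Fin (C.num b) → Bit) {ρ : Op (Fin n)}
    (hρ : ∀ a, Commute (pauliOp .Z (C.indicator b a)) ρ) :
    readoutMatrix C b ν s ⊙ ρ = flippedReadoutMatrix C b q s ⊙ ρ := by
  ext x y
  rw [Matrix.hadamard_apply, Matrix.hadamard_apply, readoutMatrix, flippedReadoutMatrix,
    Matrix.of_apply, Matrix.of_apply]
  split_ifs with hxy
  · simp only [← hxy, readout_self (hν _), flipWeight, Complex.ofReal_prod]
  · obtain ⟨a, ha⟩ := Function.ne_iff.1 hxy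
    rw [← C.indicator_dotProduct, ← C.indicator_dotProduct] at ha
    rw [apply_eq_zero_of_commute_pauliOp_Z (hρ a) ha, mul_zero, mul_zero]

/-- One layer of the code under flips: flips of the code qubits, then a measurement with flipped
outcomes. -/
noncomputable def flipLayer (C : CSSCode n) (q : Site C → ℝ) (k : ℕ) (b : Kind)
    (s : Fin (C.num b) → Bit) (ρ : Op (Fin n)) : Op (Fin n) :=
  C.flippedMeasurement b (fun a => q (.anc k b a)) s (flipNoise b (fun i => q (.code k b i)) ρ)

theorem commute_stab_flipLayer {ρ : Op (Fin n)} (h : ∀ b a, Commute (C.stab b a) ρ)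
    (q : Site C → ℝ) (k : ℕ) (b' : Kind) (s : Fin (C.num b') → Bit) (b : Kind)
    (a : Fin (C.num b)) : Commute (C.stab b a) (flipLayer C q k b' s ρ) :=
  C.commute_stab_flippedMeasurement (C.commute_stab_flipNoise (h b a) _ _) _ _ _

theorem meanLayer_eq_hadamard {μ : Loc C → ℂ} {q : Site C → ℝ}
    (hq : ∀ γ : Site C, γ.round < L → (siteCoherence L μ γ).re = 1 - 2 * q γ) (k : Fin L)
    (b : Kind) (s : Fin (C.num b) → Bit) {ρ : Op (Fin n)}
    (hρ : ∀ a, Commute (pauliOp .Z (C.indicator b a)) (hadConj ρ)) :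
    meanLayer L μ k b s ρ = flippedReadoutMatrix C b (fun a => q (.anc k b a)) s ⊙
      flipNoise .Z (fun i => q (.code k b i)) (hadConj ρ) := by
  have hcode (i : Fin n) := hq (.code k b i) k.2
  have hanc (a : Fin (C.num b)) : (ancCoherence μ k b a).re = 1 - 2 * q (.anc k b a) := by
    rw [← siteCoherence_anc (L := L), hq (.anc k b a) k.2]
  rw [meanLayer, Matrix.hadamard_assoc, readoutMatrix_hadamard_eq hanc s hρ, flipNoise_Z,
    ← Matrix.hadamard_assoc, ← Matrix.hadamard_assoc,
    Matrix.hadamard_comm (flippedReadoutMatrix C b _ s)]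
  simp only [hcode]

theorem meanLayer_X {μ : Loc C → ℂ} {q : Site C → ℝ}
    (hq : ∀ γ : Site C, γ.round < L → (siteCoherence L μ γ).re = 1 - 2 * q γ) (k : Fin L)
    (s : Fin (C.num .X) → Bit) {ρ : Op (Fin n)} (hρ : ∀ a, Commute (C.stab .X a) ρ) :
    meanLayer L μ k .X s ρ = hadConj (flipLayer C q k .X s ρ) := by
  rw [meanLayer_eq_hadamard hq k .X s fun a => by
      rw [← hadConj_pauliOp_X]; exact (hρ a).map hadConj,
    flipLayer, C.hadConj_flippedMeasurement_X, hadConj_flipNoise_X]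

theorem meanLayer_Z_hadConj {μ : Loc C → ℂ} {q : Site C → ℝ}
    (hq : ∀ γ : Site C, γ.round < L → (siteCoherence L μ γ).re = 1 - 2 * q γ) (k : Fin L)
    (s : Fin (C.num .Z) → Bit) {ρ : Op (Fin n)} (hρ : ∀ a, Commute (C.stab .Z a) ρ) :
    meanLayer L μ k .Z s (hadConj ρ) = flipLayer C q k .Z s ρ := by
  rw [meanLayer_eq_hadamard hq k .Z s fun a => by rw [hadConj_hadConj]; exact hρ a,
    flipLayer, C.flippedMeasurement_Z, hadConj_hadConj]

theorem foliationOutput_eq_flipModelOutput (S : Schedule C L) {N : Loc C → SuperOp1}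
    {μ : Loc C → ℂ} (hN : ∀ l : Loc C, l.Occurs L → N l = dephasing (μ l)) {q : Site C → ℝ}
    (hq : ∀ γ : Site C, γ.round < L → (siteCoherence L μ γ).re = 1 - 2 * q γ)
    (σ : StabOutcomes C L) {ρ : Op (Fin n)} (hρ : ∀ b a, Commute (C.stab b a) ρ) :
    foliationOutput S N σ ρ = flipModelOutput C q σ ρ := by
  rw [foliationOutput_congr S hN, foliationOutput_eq_foldl_meanLayer]
  refine (foldl_finRange_rel (fun _ ρ τ => ρ = τ ∧ ∀ b a, Commute (C.stab b a) ρ) ⟨rfl, hρ⟩ ?_).1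
  rintro k ρ _ ⟨rfl, h⟩
  have hX := commute_stab_flipLayer h q k .X (frameSyndrome σ k .X)
  have hlayer : meanLayer L μ k .Z (frameSyndrome σ k .Z)
      (meanLayer L μ k .X (frameSyndrome σ k .X) ρ) =
        flipLayer C q k .Z (frameSyndrome σ k .Z)
          (flipLayer C q k .X (frameSyndrome σ k .X) ρ) := by
    rw [meanLayer_X hq k _ (h .X), meanLayer_Z_hadConj hq k _ (hX .Z)]
  rw [hlayer]
  exact ⟨rfl, commute_stab_flipLayer hX q k .Z _⟩

end FlipModel

/-! ### Computing the Pauli channels -/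

namespace MulProg

variable {ι : Type}

theorem mults_add_one (p : MulProg ι) : p.mults + 1 = p.inputs.length := by
  induction p with
  | input l => rfl
  | mul e f he hf => rw [mults, inputs, List.length_append, ← he, ← hf]; omega

theorem eval_eq_prod (v : ι → Matrix Pauli Pauli ℂ) (p : MulProg ι) :
    p.eval v = (p.inputs.map v).prod := by
  induction p with
  | input l => simp [eval, inputs]
  | mul e f he hf => rw [eval, inputs, List.map_append, List.prod_append, he, hf]

/-- The program that multiplies the inputs `l :: t` from right to left. -/
def ofList : ι → List ι → MulProg ι
  | l, [] => .input l
  | l, l' :: t => .mul (.input l) (ofList l' t)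

theorem inputs_ofList (l : ι) (t : List ι) : (ofList l t).inputs = l :: t := by
  induction t generalizing l with
  | nil => rfl
  | cons l' t ih => rw [ofList, inputs, ih]; rfl

end MulProg

section Sites

variable {n : ℕ} {C : CSSCode n} {L : ℕ}

/-- The location after the preparation of a physical qubit. -/
def Site.prepLoc : Site C → Loc C
  | .code k b i => .codePrep k b i
  | .anc k b a => .ancPrep k b a

theorem Site.prepLoc_isPrep (γ : Site C) : γ.prepLoc.isPrep := by cases γ <;> trivial

theorem Site.locs_eq_cons (γ : Site C) : γ.locs L = γ.prepLoc :: (γ.locs L).tail := by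
  cases γ <;> rfl

theorem Site.not_isPrep_of_mem_tail {γ : Site C} {l : Loc C} (h : l ∈ (γ.locs L).tail) :
    ¬ l.isPrep := by
  cases γ <;>
    simp only [Site.locs, List.cons_append, List.tail_cons, List.mem_append, List.mem_cons,
      List.mem_map, List.nil_append] at h
  · rcases h with rfl | ⟨a, -, rfl⟩ | h
    · exact id
    · exact id
    · split_ifs at h
      · exact absurd h List.not_mem_nil
      · rw [List.mem_singleton.1 h]; exact id
  · obtain ⟨i, -, rfl⟩ := h
    exact id

theorem Site.site_of_mem_locs {γ : Site C} {l : Loc C} (h : l ∈ γ.locs L) : l.site = γ := by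
  cases γ <;> simp only [Site.locs, List.mem_append, List.mem_cons, List.mem_map] at h
  · split_ifs at h <;> aesop
  · aesop

theorem Site.occurs_of_mem_locs {γ : Site C} (hγ : γ.round < L) {l : Loc C}
    (h : l ∈ γ.locs L) : l.Occurs L := by
  have hsite := Site.site_of_mem_locs h
  exact ⟨hsite ▸ hγ, hsite ▸ h⟩

theorem Site.W_eq_length_tail_add_one (γ : Site C) : γ.W L = (γ.locs L).tail.length + 1 := by
  rw [Site.W, Site.locs_eq_cons, List.length_cons, List.tail_cons]

theorem length_filter_finRange {r : ℕ} (p : Fin r → Prop) [DecidablePred p] :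
    ((List.finRange r).filter fun i => p i).length = (Finset.univ.filter p).card := by
  rw [← List.toFinset_card_of_nodup ((List.nodup_finRange r).filter _), List.toFinset_filter,
    List.toFinset_finRange]
  simp

theorem CSSCode.degree_le_maxDegree (b : Kind) (i : Fin n) : C.degree b i ≤ C.maxDegree :=
  (Finset.le_sup (f := C.degree b) (Finset.mem_univ i)).trans
    (Finset.le_sup (f := fun b => Finset.univ.sup fun i => C.degree b i) (Finset.mem_univ b))

theorem CSSCode.card_supp_le_maxWeight (b : Kind) (a : Fin (C.num b)) :
    (C.supp b a).card ≤ C.maxWeight :=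
  (Finset.le_sup (f := fun a => (C.supp b a).card) (Finset.mem_univ a)).trans
    (Finset.le_sup (f := fun b => Finset.univ.sup fun a => (C.supp b a).card) (Finset.mem_univ b))

theorem Site.W_le (γ : Site C) : γ.W L ≤ max (C.maxWeight + 1) (C.maxDegree + 3) := by
  cases γ with
  | code k b i =>
    have hdegree := C.degree_le_maxDegree b i
    refine le_max_of_le_right ?_
    simp only [Site.W, Site.locs, List.length_append, List.length_map, length_filter_finRange,
      List.length_cons, List.length_nil]
    rw [CSSCode.degree] at hdegree
    split_ifs <;> simp only [List.length_cons, List.length_nil] <;> omega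
  | anc k b a =>
    have hweight := C.card_supp_le_maxWeight b a
    refine le_max_of_le_left ?_
    simpa only [Site.W, Site.locs, List.length_map, length_filter_finRange, List.length_cons,
      Finset.filter_univ_mem, add_le_add_iff_right] using hweight

theorem norm_siteCoherence_le_one {μ : Loc C → ℂ} (hμ : ∀ l : Loc C, l.Occurs L → ‖μ l‖ ≤ 1)
    {γ : Site C} (hγ : γ.round < L) : ‖siteCoherence L μ γ‖ ≤ 1 := by
  rw [← mem_closedBall_zero_iff]
  refine list_prod_mem (S := Submonoid.unitClosedBall ℂ) fun c hc => ?_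
  obtain ⟨l, hl, rfl⟩ := List.mem_map.1 hc
  exact mem_closedBall_zero_iff.2 (hμ l (Site.occurs_of_mem_locs hγ hl))

/-- The program that multiplies the transfer matrices at the locations of a physical qubit. -/
def siteProg (C : CSSCode n) (L : ℕ) (γ : Site C) : MulProg (Loc C) :=
  .ofList γ.prepLoc (γ.locs L).tail

theorem inputs_siteProg (γ : Site C) : (siteProg C L γ).inputs = γ.locs L := by
  rw [siteProg, MulProg.inputs_ofList, ← Site.locs_eq_cons]

variable {prog : Site C → MulProg (Loc C)} {N : Loc C → SuperOp1}

theorem xEntry_eq_re_siteCoherence {μ : Loc C → ℂ}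
    (hN : ∀ l : Loc C, l.Occurs L → N l = dephasing (μ l)) {γ : Site C} (hγ : γ.round < L)
    (hprog : (prog γ).inputs.Perm (γ.locs L)) :
    xEntry prog N γ = (siteCoherence L μ γ).re := by
  have hptm : (prog γ).inputs.map (fun l => ptm (N l)) = ((prog γ).inputs.map μ).map dephPtm := by
    rw [List.map_map]
    refine List.map_congr_left fun l hl => ?_
    rw [hN l (Site.occurs_of_mem_locs hγ (hprog.subset hl)), ptm_dephasing, Function.comp_apply]
  rw [xEntry, MulProg.eval_eq_prod, hptm, ← map_list_prod, dephPtm_X_X, Complex.ofReal_re,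
    siteCoherence, (hprog.map μ).prod_eq]

theorem one_sub_two_mul_totalFlip (γ : Site C) :
    1 - 2 * totalFlip prog N γ = xEntry prog N γ := by
  rw [totalFlip]; ring

theorem totalFlip_mem_Icc {γ : Site C} (h : |xEntry prog N γ| ≤ 1) :
    totalFlip prog N γ ∈ Set.Icc (0 : ℝ) 1 := by
  have hx := abs_le.1 h
  rw [totalFlip]
  constructor <;> linarith

variable (L prog N) in
/-- The root `|x|^{1/W}`, which is `|1 - 2 p|` at each location of a physical qubit for the flip
probability `p` there. -/
noncomputable def siteRoot (γ : Site C) : ℝ := |xEntry prog N γ| ^ ((1 : ℝ) / (γ.W L : ℝ))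

theorem siteRoot_pow (γ : Site C) :
    siteRoot L prog N γ ^ ((γ.locs L).tail.length + 1) = |xEntry prog N γ| := by
  rw [siteRoot, one_div, γ.W_eq_length_tail_add_one,
    Real.rpow_inv_natCast_pow (abs_nonneg _) (Nat.succ_ne_zero _)]

theorem locFlip_mem_Icc {l : Loc C} (h : |xEntry prog N l.site| ≤ 1) :
    locFlip L prog N l ∈ Set.Icc (0 : ℝ) 1 := by
  have hnonneg : 0 ≤ siteRoot L prog N l.site := Real.rpow_nonneg (abs_nonneg _) _
  have hle : siteRoot L prog N l.site ≤ 1 :=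
    Real.rpow_le_one (abs_nonneg _) h (by positivity)
  rw [siteRoot] at hnonneg hle
  simp only [locFlip]
  split_ifs <;> constructor <;> linarith

open Classical in
theorem one_sub_two_mul_locFlip (l : Loc C) : 1 - 2 * locFlip L prog N l =
    if xEntry prog N l.site < 0 ∧ (Odd (l.site.W L) ∨ l.isPrep) then -siteRoot L prog N l.site
    else siteRoot L prog N l.site := by
  simp only [locFlip, siteRoot]
  split_ifs <;> ring

theorem ite_neg_mul_ite_neg_pow {x r : ℝ} {k : ℕ} (h : r ^ (k + 1) = |x|) :
    (if x < 0 then -r else r) * (if x < 0 ∧ Odd (k + 1) then -r else r) ^ k = x := by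
  rcases lt_or_ge x 0 with hx | hx
  · rw [abs_of_neg hx] at h
    by_cases hk : Odd (k + 1)
    · rw [if_pos hx, if_pos ⟨hx, hk⟩, ← pow_succ', hk.neg_pow, h, neg_neg]
    · rw [if_pos hx, if_neg fun hxk => hk hxk.2, neg_mul, ← pow_succ', h, neg_neg]
  · rw [abs_of_nonneg hx] at h
    rw [if_neg hx.not_gt, if_neg fun hxk => hx.not_gt hxk.1, ← pow_succ', h]

theorem prod_one_sub_two_mul_locFlip (γ : Site C) :
    ((γ.locs L).map fun l => 1 - 2 * locFlip L prog N l).prod = xEntry prog N γ := by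
  classical
  have hprep : γ.prepLoc.site = γ := by cases γ <;> rfl
  have htail : (γ.locs L).tail.map (fun l => 1 - 2 * locFlip L prog N l) =
      List.replicate (γ.locs L).tail.length
        (if xEntry prog N γ < 0 ∧ Odd (γ.W L) then -siteRoot L prog N γ
          else siteRoot L prog N γ) := by
    rw [← List.map_const']
    refine List.map_congr_left fun l hl => ?_
    rw [one_sub_two_mul_locFlip, Site.site_of_mem_locs (List.mem_of_mem_tail hl)]
    simp only [Site.not_isPrep_of_mem_tail hl, or_false]
  rw [Site.locs_eq_cons, List.map_cons, List.prod_cons, htail, List.prod_replicate,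
    one_sub_two_mul_locFlip, hprep]
  simp only [γ.prepLoc_isPrep, or_true, and_true]
  rw [γ.W_eq_length_tail_add_one, ite_neg_mul_ite_neg_pow (siteRoot_pow γ)]

theorem siteCoherence_one_sub_two_mul_locFlip (γ : Site C) :
    siteCoherence L (fun l => ((1 - 2 * locFlip L prog N l : ℝ) : ℂ)) γ = xEntry prog N γ := by
  rw [← prod_one_sub_two_mul_locFlip (L := L), siteCoherence, ← Complex.ofRealHom_eq_coe,
    map_list_prod, List.map_map]
  rfl

end Sites

end Foliation

open Foliation in
theorem theorem2_general {n : ℕ} (C : CSSCode n) (L : ℕ) (prog : Site C → MulProg (Loc C))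
    (hprog : ∀ γ : Site C, γ.round < L → (prog γ).inputs.Perm (γ.locs L)) :
    (∀ γ : Site C, γ.round < L →
      (prog γ).mults + 1 = γ.W L ∧ γ.W L ≤ max (C.maxWeight + 1) (C.maxDegree + 3)) ∧
    ∀ N : Loc C → SuperOp1,
      (∀ l, l.Occurs L → IsChannel (N l) ∧ ptmEntry (N l) Pauli.Z.mat Pauli.Z.mat = 1) →
      (∀ l, l.Occurs L → IsPauliChannel (pauliReplacement L prog N l)) ∧
      (∀ γ : Site C, γ.round < L → totalFlip prog N γ ∈ Set.Icc 0 1) ∧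
      ∀ (S : Schedule C L) (ρ : Op (Fin n)), (∀ b a, Commute (C.stab b a) ρ) →
        ∀ σ : StabOutcomes C L,
          foliationOutput S N σ ρ = foliationOutput S (pauliReplacement L prog N) σ ρ ∧
          foliationOutput S N σ ρ = flipModelOutput C (totalFlip prog N) σ ρ := by
  refine ⟨fun γ hγ => ⟨(prog γ).mults_add_one.trans (hprog γ hγ).length_eq, γ.W_le⟩, fun N h => ?_⟩
  choose! μ hμ hN using fun l hl => exists_eq_dephasing_of_isChannel (h l hl).1 (h l hl).2
  have hx (γ : Site C) (hγ : γ.round < L) : xEntry prog N γ = (siteCoherence L μ γ).re :=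
    xEntry_eq_re_siteCoherence hN hγ (hprog γ hγ)
  have hx_le (γ : Site C) (hγ : γ.round < L) : |xEntry prog N γ| ≤ 1 :=
    hx γ hγ ▸ (Complex.abs_re_le_norm _).trans (norm_siteCoherence_le_one hμ hγ)
  refine ⟨fun l hl => phaseFlip_isPauliChannel (locFlip_mem_Icc (hx_le l.site hl.1)),
    fun γ hγ => totalFlip_mem_Icc (hx_le γ hγ), fun S ρ hρ σ => ?_⟩
  have hflip : foliationOutput S N σ ρ = flipModelOutput C (totalFlip prog N) σ ρ :=
    foliationOutput_eq_flipModelOutput S hN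
      (fun γ hγ => by rw [one_sub_two_mul_totalFlip, hx γ hγ]) σ hρ
  have hpauli : foliationOutput S (pauliReplacement L prog N) σ ρ =
      flipModelOutput C (totalFlip prog N) σ ρ :=
    foliationOutput_eq_flipModelOutput S (fun l _ => phaseFlip_eq_dephasing (locFlip L prog N l))
      (fun γ _ => by rw [one_sub_two_mul_totalFlip, siteCoherence_one_sub_two_mul_locFlip,
        Complex.ofReal_re]) σ hρ
  exact ⟨hflip.trans hpauli.symm, hflip⟩

theorem theorem2 {n : ℕ} (C : Foliation.CSSCode n) (L : ℕ) :
    ∃ prog : Foliation.Site C → Foliation.MulProg (Foliation.Loc C),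
      (∀ γ : Foliation.Site C, γ.round < L →
        (prog γ).inputs.Perm (γ.locs L) ∧
        (prog γ).mults + 1 = γ.W L ∧
        γ.W L ≤ max (C.maxWeight + 1) (C.maxDegree + 3)) ∧
      ∀ N : Foliation.Loc C → Foliation.SuperOp1,
        (∀ l, l.Occurs L → Foliation.IsChannel (N l) ∧ Foliation.PureZ (N l)) →
        (∀ l, l.Occurs L →
          Foliation.IsPauliChannel (Foliation.pauliReplacement L prog N l)) ∧
        (∀ γ : Foliation.Site C, γ.round < L → Foliation.totalFlip prog N γ ∈ Set.Icc 0 1) ∧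
        ∀ (S : Foliation.Schedule C L) (ρ : Foliation.Op (Fin n)), C.IsCodeOp ρ →
          ∀ σ : Foliation.StabOutcomes C L,
            Foliation.foliationOutput S N σ ρ =
              Foliation.foliationOutput S (Foliation.pauliReplacement L prog N) σ ρ ∧
            Foliation.foliationOutput S N σ ρ =
              Foliation.flipModelOutput C (Foliation.totalFlip prog N) σ ρ := by
  obtain ⟨hmults, hequiv⟩ := theorem2_general C L (Foliation.siteProg C L) fun γ _ =>
    .of_eq (Foliation.inputs_siteProg γ)
  exact ⟨_, fun γ hγ => ⟨.of_eq (Foliation.inputs_siteProg γ), hmults γ hγ⟩, fun N hN =>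
    (hequiv N fun l hl => ⟨(hN l hl).1, (hN l hl).2.2⟩).imp_right (.imp_right fun h S ρ hρ =>
      h S ρ fun b a => (hρ b a).1.trans (hρ b a).2.symm)⟩
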